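/- Let $d\ge 3$ and $\mathbb I=[0,1]$. A $d$-dimensional copula $C$ is the restriction to $\mathbb I^d$ of the distribution function of a probability measure $\mu_C$ on $\mathbb I^d$ with uniform one-dimensional marginals. An Archimedean generator is a continuous non-increasing function $\psi:[0,\infty)\to[0,1]$ with $\psi(0)=1$ and $\lim_{z\to\infty}\psi(z)=0=:\psi(\infty)$ that is strictly decreasing on $[0,\inf\{z\in[0,\infty]:\psi(z)=0\}]$; its pseudo-inverse is $\varphi(y)=\inf\{z\in[0,\infty]:\psi(z)=y\}$, $y\in[0,1]$. A $d$-dimensional copula $C$ is Archimedean, $C\in\mathcal C_{ar}^d$, if $C(x)=\psi(\varphi(x_1)+\dots+\varphi(x_d))$ on $\mathbb I^d$ for some Archimedean generator $\psi$. Equip $\mathcal C_{ar}^d$ with the uniform metric $d_\infty(A,B)=\sup_{x\in\mathbb I^d}|A(x)-B(x)|$. For a copula $C$ let $\mu_{C^{1:d-1}}$ be the marginal of $\mu_C$ on the first $d-1$ coordinates, and let $K_C(\mathbf x,\cdot)$, $\mathbf x\in\mathbb I^{d-1}$, be the Markov kernel (regular conditional distribution) of the last coordinate given the first $d-1$ coordinates.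 Decompose $K_C(\mathbf x,\cdot)=K_C^{dis}(\mathbf x,\cdot)+K_C^{sing}(\mathbf x,\cdot)+K_C^{abs}(\mathbf x,\cdot)$ into its discrete part, its part that is singular with respect to Lebesgue measure and has no point masses, and its absolutely continuous part. For Borel sets $G\subseteq\mathbb I^d$ with sections $G_{\mathbf x}=\{y:(\mathbf x,y)\in G\}$ put $$\mu_C^{dis}(G)=\int_{\mathbb I^{d-1}}K_C^{dis}(\mathbf x,G_{\mathbf x})\,d\mu_{C^{1:d-1}}(\mathbf x),\qquad \mu_C^{sing}(G)=\int_{\mathbb I^{d-1}}K_C^{sing}(\mathbf x,G_{\mathbf x})\,d\mu_{C^{1:d-1}}(\mathbf x).$$ Then each of the three families $$\mathcal C_{ar,dis}^d=\{C\in\mathcal C_{ar}^d:\mu_C^{dis}(\mathbb I^d)=1\},$$ $$\mathcal C_{ar,abs}^d=\{C\in\mathcal C_{ar}^d:\mu_C\text{ is absolutely continuous with respect to Lebesgue measure on }\mathbb I^d\},$$ $$\mathcal C_{ar,sing}^d=\{C\in\mathcal C_{ar}^d:\mu_C^{sing}(\mathbb I^d)=1\}$$ is dense in $(\mathcal C_{ar}^d,d_\infty)$.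 -/

import Mathlib

open MeasureTheory ProbabilityTheory
open scoped unitInterval ENNReal NNReal Topology

noncomputable section

/-- A `d`-dimensional copula: the restriction to `[0,1]^d` of the distribution function of a
probability measure on `[0,1]^d` all of whose one-dimensional marginals are uniform. -/
@[ext]
structure Copula (d : ℕ) where
  toFun : (Fin d → I) → ℝ
  exists_measure : ∃ μ : Measure (Fin d → I), IsProbabilityMeasure μ ∧
    (∀ i, μ.map (fun x => x i) = volume) ∧ ∀ x, μ.real (Set.Iic x) = toFun x

namespace Copula

instance (d : ℕ) : CoeFun (Copula d) (fun _ => (Fin d → I) → ℝ) := ⟨Copula.toFun⟩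

/-- The `d`-stochastic measure `μ_C` of a copula, `μ_C([0,x]) = C(x)`. -/
def measure {d : ℕ} (C : Copula d) : Measure (Fin d → I) := C.exists_measure.choose

instance {d : ℕ} (C : Copula d) : IsProbabilityMeasure C.measure :=
  C.exists_measure.choose_spec.1

theorem measure_real_Iic {d : ℕ} (C : Copula d) (x : Fin d → I) :
    C.measure.real (Set.Iic x) = C x :=
  C.exists_measure.choose_spec.2.2 x

theorem map_measure {d : ℕ} (C : Copula d) (i : Fin d) :
    C.measure.map (fun x => x i) = volume :=
  C.exists_measure.choose_spec.2.1 i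

/-- `μ_C` is the only finite measure with `μ_C([0,x]) = C(x)`. -/
theorem measure_unique {d : ℕ} (C : Copula d) (μ : Measure (Fin d → I)) [IsFiniteMeasure μ]
    (h : ∀ x, μ.real (Set.Iic x) = C x) : μ = C.measure := by
  have hI : ∀ x, μ (Set.Iic x) = C.measure (Set.Iic x) := fun x => by
    have := (h x).trans (C.measure_real_Iic x).symm
    simpa [Measure.real, ENNReal.toReal_eq_toReal_iff'] using this
  have huniv : (Set.Iic (fun _ : Fin d => (1 : I))) = Set.univ :=
    Set.eq_univ_of_forall fun x i => unitInterval.le_one'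
  refine ext_of_generate_finite
    (Set.pi Set.univ '' Set.pi Set.univ fun _ : Fin d => Set.range (Set.Iic : I → Set I))
    ?_ ?_ ?_ ?_
  · refine (generateFrom_eq_pi (C := fun _ : Fin d => Set.range (Set.Iic : I → Set I))
      (fun _ => ?_) (fun _ => ?_)).symm
    · exact (borel_eq_generateFrom_Iic I).symm.trans (BorelSpace.measurable_eq (α := I)).symm
    · exact ⟨fun _ => Set.Iic 1, fun _ => ⟨1, rfl⟩,
        Set.iUnion_eq_univ_iff.2 fun x => ⟨0, unitInterval.le_one'⟩⟩
  · exact IsPiSystem.pi fun _ => isPiSystem_Iic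
  · rintro _ ⟨s, hs, rfl⟩
    choose a ha using fun i => hs i (Set.mem_univ i)
    have : Set.pi Set.univ s = Set.Iic a := by
      rw [← Set.pi_univ_Iic]
      exact Set.pi_congr rfl fun i _ => (ha i).symm
    rw [this]
    exact hI a
  · rw [← huniv]
    exact hI _

theorem nonneg {d : ℕ} (C : Copula d) (x : Fin d → I) : 0 ≤ C x := by
  rw [← C.measure_real_Iic]; exact measureReal_nonneg

theorem le_one {d : ℕ} (C : Copula d) (x : Fin d → I) : C x ≤ 1 := by
  rw [← C.measure_real_Iic]; exact measureReal_le_one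

theorem bddAbove_abs_sub {d : ℕ} (A B : Copula d) :
    BddAbove (Set.range fun x => |A x - B x|) := by
  refine ⟨1, ?_⟩
  rintro _ ⟨x, rfl⟩
  exact abs_sub_le_iff.2 ⟨by linarith [A.le_one x, B.nonneg x], by linarith [B.le_one x, A.nonneg x]⟩

/-- The uniform metric `d_∞(A, B) = sup_x |A(x) - B(x)|` on the set of `d`-dimensional copulas. -/
instance (d : ℕ) : MetricSpace (Copula d) where
  dist A B := ⨆ x : Fin d → I, |A x - B x|
  dist_self A := by simp
  dist_comm A B := by simp only [abs_sub_comm]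
  dist_triangle A B C := ciSup_le fun x =>
    (abs_sub_le (A x) (B x) (C x)).trans
      (add_le_add (le_ciSup (bddAbove_abs_sub A B) x) (le_ciSup (bddAbove_abs_sub B C) x))
  eq_of_dist_eq_zero {A B} h := by
    ext x
    have h1 : |A x - B x| ≤ 0 := (le_ciSup (bddAbove_abs_sub A B) x).trans h.le
    exact sub_eq_zero.1 (abs_eq_zero.1 (le_antisymm h1 (abs_nonneg _)))

end Copula

/-- The extension of `ψ : [0,∞) → [0,1]` to `[0,∞]` by `ψ(∞) = 0`. -/
def generatorExt (ψ : ℝ≥0 → I) (z : ℝ≥0∞) : I := if z = ∞ then 0 else ψ z.toNNReal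

/-- The pseudo-inverse `φ(y) = inf {z ∈ [0,∞] : ψ(z) = y}`, with values in `[0,∞]`. -/
def pseudoInverse (ψ : ℝ≥0 → I) (y : I) : ℝ≥0∞ := sInf {z : ℝ≥0∞ | generatorExt ψ z = y}

/-- Archimedean generators. -/
structure IsGenerator (ψ : ℝ≥0 → I) : Prop where
  continuous : Continuous ψ
  antitone : Antitone ψ
  map_zero : ψ 0 = 1
  tendsto_zero : Filter.Tendsto ψ Filter.atTop (𝓝 0)
  strictAntiOn : StrictAntiOn (generatorExt ψ) (Set.Icc 0 (sInf {z | generatorExt ψ z = 0}))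

/-- Discrete part of a measure on `[0,1]`: its restriction to the set of its atoms. -/
def discretePart (ν : Measure I) : Measure I := ν.restrict {y | ν {y} ≠ 0}

/-- Absolutely continuous part of a measure on `[0,1]` with respect to Lebesgue measure. -/
def absContPart (ν : Measure I) : Measure I := volume.withDensity (ν.rnDeriv volume)

/-- Singular continuous part of a measure on `[0,1]`: the Lebesgue-singular part without the
atoms. -/
def singContPart (ν : Measure I) : Measure I :=
  (ν.singularPart volume).restrict {y | ν {y} = 0}

theorem measurableSet_atoms {α : Type*} [MeasurableSpace α] (κ : Kernel α I) [IsFiniteKernel κ] :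
    MeasurableSet {p : α × I | κ p.1 {p.2} = 0} := by
  have hd : MeasurableSet {q : (α × I) × I | q.2 = q.1.2} :=
    measurableSet_eq_fun measurable_snd (measurable_snd.comp measurable_fst)
  have h := Kernel.measurable_kernel_prodMk_left (κ := κ.comap Prod.fst measurable_fst) hd
  have h' : Measurable fun p : α × I => κ p.1 {p.2} := by
    refine (congrArg Measurable ?_).mp h
    funext p
    rw [Kernel.comap_apply]
    rfl
  exact h' (measurableSet_singleton 0)

theorem measurable_restrict_section {α : Type*} [MeasurableSpace α] (κ : Kernel α I)
    [IsFiniteKernel κ] {S : Set (α × I)} (hS : MeasurableSet S) :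
    Measurable fun x => (κ x).restrict {y | (x, y) ∈ S} := by
  refine Measure.measurable_of_measurable_coe _ fun s hs => ?_
  have h := Kernel.measurable_kernel_prodMk_left (κ := κ) ((measurable_snd hs).inter hS)
  refine (congrArg Measurable ?_).mp h
  funext x
  rw [Measure.restrict_apply hs]
  rfl

/-- Every finite measure on `[0,1]` is the sum of its three parts. -/
theorem parts_add (ν : Measure I) [IsFiniteMeasure ν] :
    discretePart ν + singContPart ν + absContPart ν = ν := by
  have hc : {y | ν {y} ≠ 0}.Countable := by
    have := Measure.countable_meas_pos_of_disjoint_iUnion (μ := ν) (As := fun y : I => {y})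
      (fun y => measurableSet_singleton y) (fun a b hab => by simpa using hab)
    simpa [pos_iff_ne_zero] using this
  have hA := hc.measurableSet
  have hcompl : {y | ν {y} = 0} = {y | ν {y} ≠ 0}ᶜ := by ext y; simp
  have h0 : (absContPart ν).restrict {y | ν {y} ≠ 0} = 0 :=
    Measure.restrict_eq_zero.2 (withDensity_absolutelyContinuous _ _ (hc.measure_zero volume))
  have hd : discretePart ν = (ν.singularPart volume).restrict {y | ν {y} ≠ 0} := by
    have h1 : ν.singularPart volume + absContPart ν = ν := Measure.singularPart_add_rnDeriv _ _
    calc discretePart ν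
        = (ν.singularPart volume + absContPart ν).restrict {y | ν {y} ≠ 0} := by
          rw [h1]; rfl
      _ = _ := by rw [Measure.restrict_add, h0, add_zero]
  rw [hd, singContPart, hcompl, Measure.restrict_add_restrict_compl hA]
  exact Measure.singularPart_add_rnDeriv _ _

/-- The discrete part of a Markov kernel, `x ↦ κ(x,·)^dis`. -/
def discreteKernel {α : Type*} [MeasurableSpace α] (κ : Kernel α I) [IsFiniteKernel κ] :
    Kernel α I where
  toFun x := discretePart (κ x)
  measurable' := measurable_restrict_section κ (measurableSet_atoms κ).compl

/-- The singular continuous part of a Markov kernel, `x ↦ κ(x,·)^sing`. -/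
def singContKernel {α : Type*} [MeasurableSpace α] (κ : Kernel α I) [IsFiniteKernel κ] :
    Kernel α I where
  toFun x := singContPart (κ x)
  measurable' := by
    refine (congrArg Measurable ?_).mp
      (measurable_restrict_section (Kernel.singularPart κ (Kernel.const α volume))
        (measurableSet_atoms κ))
    funext x
    rw [Kernel.singularPart_eq_singularPart_measure]
    rfl

instance {α : Type*} [MeasurableSpace α] (κ : Kernel α I) [IsFiniteKernel κ] :
    IsFiniteKernel (discreteKernel κ) :=
  ⟨κ.bound, κ.bound_lt_top, fun x =>
    (Measure.restrict_le_self _).trans (Kernel.measure_le_bound κ x _)⟩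

instance {α : Type*} [MeasurableSpace α] (κ : Kernel α I) [IsFiniteKernel κ] :
    IsFiniteKernel (singContKernel κ) :=
  ⟨κ.bound, κ.bound_lt_top, fun x =>
    (Measure.restrict_le_self.trans (Measure.singularPart_le _ _) _).trans
      (Kernel.measure_le_bound κ x _)⟩

namespace Copula

/-- `C` is Archimedean: `C(x) = ψ(φ(x_1) + ⋯ + φ(x_d))` for some generator `ψ`. -/
def IsArchimedean {d : ℕ} (C : Copula d) : Prop :=
  ∃ ψ : ℝ≥0 → I, IsGenerator ψ ∧
    ∀ x, C x = (generatorExt ψ (∑ i, pseudoInverse ψ (x i)) : ℝ)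

/-- `μ_C` on `[0,1]^n × [0,1]`, where `d = n + 1`: the last coordinate is split off. -/
def splitMeasure {n : ℕ} (C : Copula (n + 1)) : Measure ((Fin n → I) × I) :=
  C.measure.map fun x => (fun i => x i.castSucc, x (Fin.last n))

instance {n : ℕ} (C : Copula (n + 1)) : IsProbabilityMeasure C.splitMeasure :=
  Measure.isProbabilityMeasure_map (by fun_prop)

/-- The measure of the marginal copula `C^{1:d-1}` of the first `d - 1 = n` coordinates. -/
def marginal {n : ℕ} (C : Copula (n + 1)) : Measure (Fin n → I) := C.splitMeasure.fst

instance {n : ℕ} (C : Copula (n + 1)) : IsProbabilityMeasure C.marginal := by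
  unfold marginal; infer_instance

/-- The `(d-1)`-Markov kernel `K_C` of `C`: the regular conditional distribution of the last
coordinate given the first `d - 1 = n` ones. -/
def kernel {n : ℕ} (C : Copula (n + 1)) : Kernel (Fin n → I) I := C.splitMeasure.condKernel

instance {n : ℕ} (C : Copula (n + 1)) : IsMarkovKernel C.kernel := by
  unfold kernel; infer_instance

/-- The discrete component of `μ_C`,
`μ_C^dis(G) = ∫ K_C^dis(x, G_x) dμ_{C^{1:d-1}}(x)` for Borel `G ⊆ [0,1]^n × [0,1]`. -/
def discreteComponent {n : ℕ} (C : Copula (n + 1)) : Measure ((Fin n → I) × I) :=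
  C.marginal ⊗ₘ discreteKernel C.kernel

/-- The singular (continuous) component of `μ_C`,
`μ_C^sing(G) = ∫ K_C^sing(x, G_x) dμ_{C^{1:d-1}}(x)`. -/
def singularComponent {n : ℕ} (C : Copula (n + 1)) : Measure ((Fin n → I) × I) :=
  C.marginal ⊗ₘ singContKernel C.kernel

/-- `C` is absolutely continuous: `μ_C` has a density with respect to Lebesgue measure. -/
def IsAbsolutelyContinuous {d : ℕ} (C : Copula d) : Prop := C.measure ≪ volume

end Copula

/-- The set `C_ar^d` of `d`-dimensional Archimedean copulas, with the metric `d_∞`. -/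
abbrev ArchimedeanCopula (d : ℕ) : Type := {C : Copula d // C.IsArchimedean}

end

/-! Write d = n + 1. Archimedean copulas correspond to radial laws. If γ is a probability measure on
(0,∞), R ∼ γ, and Z is uniform on {z ≥ 0, ∑ z_i = R} given R, then Z has survival function ψ(∑ z_i),
where ψ(s) = ∫ (1 - s/r)_+^n dγ(r) is the Williamson transform. Applying ψ coordinatewise to Z gives
an Archimedean copula (`simplexMixture_survival`, `IsGenerator.exists_copula`).

Conversely, every generator of a copula is a uniform limit of such transforms with γ discrete. On a
grid εℕ the iterated differences of ψ are masses of boxes, hence nonnegative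
(`Copula.measure_real_box`). Repeated summation expresses ψ(jε) as a mixture of binomial ratios,
which are close to (1 - j/(k+1))_+^n (`IsGenerator.exists_weights`).

The law γ controls the conditional laws: once the first n coordinates are fixed, the last one is a
function of R alone. A countable carrier of γ gives discrete kernels, an atomless γ on a null set
gives singular continuous ones, and γ ≪ Lebesgue gives an absolutely continuous copula.

It remains to change the type of γ at small cost. Replacing R by R(1 + δV), with V independent of R
and either uniform on [0,1] or atomless on the Cantor set, moves the transform by at most nδ
(`abs_williamson_perturb_sub_le`). Uniformly close generators give uniformly close copulas
(`Copula.dist_le_of_generator`). -/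

/-! ### Archimedean generators and their pseudo-inverses -/

namespace IsGenerator

variable {ψ : ℝ≥0 → I}

theorem generatorExt_antitone (hψ : IsGenerator ψ) : Antitone (generatorExt ψ) := by
  intro a b hab
  unfold generatorExt
  split_ifs with h1 h2 h2
  · exact le_rfl
  · exact bot_le
  · exact absurd (top_le_iff.1 (h2 ▸ hab)) h1
  · exact hψ.antitone (ENNReal.toNNReal_mono h1 hab)

theorem pseudoInverse_apply (hψ : IsGenerator ψ) {z : ℝ≥0} (hz : ψ z ≠ 0) :
    pseudoInverse ψ (ψ z) = z := by
  have hle : ∀ w : ℝ≥0∞, generatorExt ψ w ≠ 0 →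
      w ∈ Set.Icc 0 (sInf {z | generatorExt ψ z = 0}) := by
    intro w hw
    refine ⟨zero_le, le_sInf fun t ht => ?_⟩
    by_contra! h
    have := hψ.generatorExt_antitone h.le
    rw [show generatorExt ψ t = 0 from ht] at this
    exact hw (le_antisymm this bot_le)
  have hz' : generatorExt ψ z = ψ z := by simp [generatorExt]
  have : {w : ℝ≥0∞ | generatorExt ψ w = ψ z} = {(z : ℝ≥0∞)} := by
    ext w
    simp only [Set.mem_ofPred_eq, Set.mem_singleton_iff]
    refine ⟨fun h => ?_, fun h => h ▸ hz'⟩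
    exact hψ.strictAntiOn.injOn (hle w (h ▸ hz)) (hle z (hz'.symm ▸ hz)) (h.trans hz'.symm)
  rw [pseudoInverse, this, sInf_singleton]

theorem exists_eq (hψ : IsGenerator ψ) {y : I} (hy : y ≠ 0) : ∃ z, ψ z = y := by
  have h0 : (0 : I) < y := bot_lt_iff_ne_bot.2 hy
  obtain ⟨w, hw⟩ := (hψ.tendsto_zero.eventually (gt_mem_nhds h0)).exists
  have := intermediate_value_Icc' (α := ℝ≥0) (zero_le (a := w)) hψ.continuous.continuousOn
  obtain ⟨z, -, hz⟩ := this ⟨hw.le, hψ.map_zero ▸ unitInterval.le_one'⟩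
  exact ⟨z, hz⟩

/-- At level 0 the level set may be a half-line. Its infimum, when finite, is attained by continuity
of ψ from the right. -/
theorem generatorExt_pseudoInverse_zero (hψ : IsGenerator ψ) :
    generatorExt ψ (pseudoInverse ψ 0) = 0 := by
  by_cases h : pseudoInverse ψ 0 = ∞
  · simp [generatorExt, h]
  obtain ⟨t, ht⟩ := WithTop.ne_top_iff_exists.1 h
  replace ht : (t : ℝ≥0∞) = pseudoInverse ψ 0 := ht
  rw [← ht]
  have hzero : ∀ t' > t, ψ t' = 0 := by
    intro t' htt'
    have : pseudoInverse ψ 0 < t' := by rw [← ht]; exact_mod_cast htt'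
    obtain ⟨w, hw, hwt⟩ := sInf_lt_iff.1 this
    have h1 := hψ.generatorExt_antitone hwt.le
    rw [show generatorExt ψ w = 0 from hw] at h1
    have h2 : generatorExt ψ t' = ψ t' := by simp [generatorExt]
    rw [h2] at h1
    exact le_antisymm h1 bot_le
  have h1 : Filter.Tendsto ψ (𝓝[>] t) (𝓝 (ψ t)) :=
    (hψ.continuous.tendsto t).mono_left nhdsWithin_le_nhds
  have h2 : Filter.Tendsto ψ (𝓝[>] t) (𝓝 0) := by
    refine tendsto_const_nhds.congr' ?_
    filter_upwards [self_mem_nhdsWithin] with x hx using (hzero x hx).symm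
  simpa [generatorExt] using tendsto_nhds_unique h1 h2

theorem eq_zero_of_le (hψ : IsGenerator ψ) {a b : ℝ≥0} (hab : a ≤ b) (ha : ψ a = 0) : ψ b = 0 :=
  le_antisymm (ha ▸ hψ.antitone hab) bot_le

end IsGenerator

/-! ### Lipschitz continuity of copulas and dependence on the generator -/

namespace Copula

variable {d : ℕ}

theorem measure_coord_Ioc (C : Copula d) (i : Fin d) (a b : I) :
    C.measure.real {u | u i ∈ Set.Ioc a b} = max 0 ((b : ℝ) - a) := by
  have : {u : Fin d → I | u i ∈ Set.Ioc a b} = (fun x => x i) ⁻¹' Set.Ioc a b := rfl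
  rw [this, measureReal_def, ← Measure.map_apply (measurable_pi_apply i) measurableSet_Ioc,
    C.map_measure, unitInterval.volume_Ioc, ENNReal.toReal_ofReal', max_comm]

theorem eq_zero_of_coord (C : Copula d) {x : Fin d → I} {i : Fin d} (hi : x i = 0) : C x = 0 := by
  refine le_antisymm ?_ (C.nonneg x)
  rw [← C.measure_real_Iic]
  have h : C.measure ((fun x => x i) ⁻¹' Set.Iic (0 : I)) = 0 := by
    rw [← Measure.map_apply (measurable_pi_apply i) measurableSet_Iic,
      C.map_measure, unitInterval.volume_Iic]
    simp
  have : C.measure (Set.Iic x) = 0 :=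
    measure_mono_null (fun u hu => show u i ≤ 0 from hi ▸ hu i) h
  simp [measureReal_def, this]

/-- The box below x is covered by the box below y and the strips y_i < u_i ≤ x_i, whose masses are
read off the uniform marginals. -/
theorem sub_le (C : Copula d) (x y : Fin d → I) : C x - C y ≤ ∑ i, |(x i : ℝ) - y i| := by
  rw [← C.measure_real_Iic, ← C.measure_real_Iic]
  have hsub : Set.Iic x ⊆ Set.Iic y ∪ ⋃ i, {u | u i ∈ Set.Ioc (y i) (x i)} := by
    intro u hu
    by_cases h : u ≤ y
    · exact Or.inl h
    · obtain ⟨i, hi⟩ := not_forall.1 h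
      exact Or.inr (Set.mem_iUnion.2 ⟨i, not_le.1 hi, hu i⟩)
  have h1 : C.measure.real (Set.Iic x) ≤
      C.measure.real (Set.Iic y) + ∑ i, C.measure.real {u | u i ∈ Set.Ioc (y i) (x i)} :=
    (measureReal_mono hsub).trans ((measureReal_union_le _ _).trans
      (add_le_add le_rfl (measureReal_iUnion_fintype_le _)))
  have h2 : ∑ i, C.measure.real {u | u i ∈ Set.Ioc (y i) (x i)} ≤ ∑ i, |(x i : ℝ) - y i| := by
    refine Finset.sum_le_sum fun i _ => ?_
    rw [measure_coord_Ioc]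
    exact max_le (abs_nonneg _) (le_abs_self _)
  linarith

theorem abs_sub_le (C : Copula d) (x y : Fin d → I) : |C x - C y| ≤ ∑ i, |(x i : ℝ) - y i| := by
  refine abs_sub_le_iff.2 ⟨C.sub_le x y, ?_⟩
  simpa only [abs_sub_comm] using C.sub_le y x

/-- The Archimedean representation, evaluated along the generator. -/
theorem apply_generator (C : Copula d) {ψ : ℝ≥0 → I} (hψ : IsGenerator ψ)
    (hC : ∀ x, C x = (generatorExt ψ (∑ i, pseudoInverse ψ (x i)) : ℝ)) (z : Fin d → ℝ≥0) :
    C (fun i => ψ (z i)) = ψ (∑ i, z i) := by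
  -- The pseudo-inverse recovers z_i only where ψ(z_i) ≠ 0; otherwise both sides vanish.
  by_cases h : ∃ i, ψ (z i) = 0
  · obtain ⟨i, hi⟩ := h
    rw [C.eq_zero_of_coord (i := i) hi, hψ.eq_zero_of_le
      (Finset.single_le_sum (f := z) (fun _ _ => zero_le) (Finset.mem_univ i)) hi]
    simp
  · push Not at h
    rw [hC]
    simp only [hψ.pseudoInverse_apply (h _)]
    rw [← ENNReal.ofNNReal_finsetSum, generatorExt, if_neg ENNReal.coe_ne_top,
      ENNReal.toNNReal_coe]

/-- Only ψ' has to be inverted: with x = ψ'(z), passing from C(ψ'(z)) to C(ψ(z)) = ψ(∑ z_i) costs dη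
by the Lipschitz bound, and passing from there to ψ'(∑ z_i) costs one more η. -/
theorem dist_le_of_generator {C C' : Copula d} {ψ ψ' : ℝ≥0 → I} (hψ' : IsGenerator ψ')
    (hC : ∀ z : Fin d → ℝ≥0, C (fun i => ψ (z i)) = ψ (∑ i, z i))
    (hC' : ∀ z : Fin d → ℝ≥0, C' (fun i => ψ' (z i)) = ψ' (∑ i, z i)) {η : ℝ} (hη : 0 ≤ η)
    (h : ∀ z, |(ψ z : ℝ) - ψ' z| ≤ η) : dist C C' ≤ (d + 1) * η := by
  refine ciSup_le fun x => ?_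
  by_cases hx : ∃ i, x i = 0
  · obtain ⟨i, hi⟩ := hx
    rw [C.eq_zero_of_coord hi, C'.eq_zero_of_coord hi]
    simp only [sub_self, abs_zero]
    positivity
  · push Not at hx
    choose z hz using fun i => hψ'.exists_eq (hx i)
    obtain rfl : (fun i => ψ' (z i)) = x := funext hz
    have h1 := C.abs_sub_le (fun i => ψ' (z i)) (fun i => ψ (z i))
    have h2 : ∑ i, |(ψ' (z i) : ℝ) - ψ (z i)| ≤ ∑ _i : Fin d, η :=
      Finset.sum_le_sum fun i _ => by rw [abs_sub_comm]; exact h _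
    rw [hC] at h1
    rw [hC']
    have h3 := h (∑ i, z i)
    simp only [Finset.sum_const, Finset.card_univ, Fintype.card_fin, nsmul_eq_mul] at h2
    have := abs_sub_le_iff.1 (h1.trans h2)
    have := abs_sub_le_iff.1 h3
    rw [abs_sub_le_iff]
    constructor <;> linarith

end Copula

/-! ### Multiple monotonicity of a copula generator along grids -/

/-- Iterated backward differences `(1 - E)^k a` of a sequence, `E` being the shift. -/
def iterDiff (a : ℕ → ℝ) : ℕ → ℕ → ℝ
  | 0, j => a j
  | k + 1, j => iterDiff a k j - iterDiff a k (j + 1)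

/-- Bounding one more coordinate i from below removes the same box with w_i raised by one. Since
masses depend on w only through its sum, this applies one further backward difference. -/
theorem Copula.measure_real_box {d : ℕ} (C : Copula d) {ψ : ℝ≥0 → I} (hψ : Antitone ψ)
    (hC : ∀ z : Fin d → ℝ≥0, C (fun i => ψ (z i)) = ψ (∑ i, z i)) (ε : ℝ≥0) (T : Finset (Fin d))
    (w : Fin d → ℕ) :
    C.measure.real {u | (∀ i, u i ≤ ψ (w i * ε)) ∧ ∀ i ∈ T, ψ ((w i + 1 : ℕ) * ε) < u i} =
      iterDiff (fun j => (ψ (j * ε) : ℝ)) T.card (∑ i, w i) := by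
  classical
  induction T using Finset.induction_on generalizing w with
  | empty =>
    have : {u : Fin d → I | (∀ i, u i ≤ ψ (w i * ε)) ∧ ∀ i ∈ (∅ : Finset (Fin d)),
        ψ ((w i + 1 : ℕ) * ε) < u i} = Set.Iic (fun i => ψ (w i * ε)) := by
      ext u; simp [Pi.le_def]
    rw [this, C.measure_real_Iic, hC fun i => (w i : ℝ≥0) * ε]
    simp [iterDiff, Finset.sum_mul]
  | insert i T hi ih =>
    set w' := Function.update w i (w i + 1) with hw'
    have hw'i : w' i = w i + 1 := by simp [w']
    have hw'j : ∀ j, j ≠ i → w' j = w j := fun j hj => by simp [w', hj]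
    have hsum : ∑ j, w' j = ∑ j, w j + 1 := by
      rw [← Finset.add_sum_erase _ _ (Finset.mem_univ i), ← Finset.add_sum_erase _ w
        (Finset.mem_univ i), hw'i, Finset.sum_congr rfl fun j hj =>
          hw'j j (Finset.ne_of_mem_erase hj)]
      ring
    have hmono : ψ ((w i + 1 : ℕ) * ε) ≤ ψ (w i * ε) :=
      hψ (mul_le_mul_left (by exact_mod_cast Nat.le_succ _) _)
    have hset : {u : Fin d → I | (∀ j, u j ≤ ψ (w j * ε)) ∧ ∀ j ∈ insert i T,
          ψ ((w j + 1 : ℕ) * ε) < u j} =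
        {u | (∀ j, u j ≤ ψ (w j * ε)) ∧ ∀ j ∈ T, ψ ((w j + 1 : ℕ) * ε) < u j} \
        {u | (∀ j, u j ≤ ψ (w' j * ε)) ∧ ∀ j ∈ T, ψ ((w' j + 1 : ℕ) * ε) < u j} := by
      ext u
      simp only [Finset.mem_insert, forall_eq_or_imp, Set.mem_sdiff, Set.mem_ofPred_eq]
      constructor
      · rintro ⟨h1, h2, h3⟩
        exact ⟨⟨h1, h3⟩, fun h => absurd (hw'i ▸ h.1 i) (not_le.2 h2)⟩
      · rintro ⟨⟨h1, h2⟩, h3⟩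
        refine ⟨h1, ?_, h2⟩
        by_contra! h
        refine h3 ⟨fun j => ?_, fun j hj => ?_⟩
        · by_cases hj : j = i
          · rw [hj, hw'i]; exact h
          · rw [hw'j j hj]; exact h1 j
        · rw [hw'j j (fun h => hi (h ▸ hj))]; exact h2 j hj
    have hsub : {u : Fin d → I | (∀ j, u j ≤ ψ (w' j * ε)) ∧
          ∀ j ∈ T, ψ ((w' j + 1 : ℕ) * ε) < u j} ⊆
        {u | (∀ j, u j ≤ ψ (w j * ε)) ∧ ∀ j ∈ T, ψ ((w j + 1 : ℕ) * ε) < u j} := by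
      rintro u ⟨h1, h2⟩
      refine ⟨fun j => ?_, fun j hj => ?_⟩
      · by_cases hj : j = i
        · rw [hj]; exact (hw'i ▸ h1 i).trans hmono
        · rw [← hw'j j hj]; exact h1 j
      · rw [← hw'j j (fun h => hi (h ▸ hj))]; exact h2 j hj
    have hmeas : MeasurableSet {u : Fin d → I | (∀ j, u j ≤ ψ (w' j * ε)) ∧
          ∀ j ∈ T, ψ ((w' j + 1 : ℕ) * ε) < u j} := by
      have : {u : Fin d → I | (∀ j, u j ≤ ψ (w' j * ε)) ∧
          ∀ j ∈ T, ψ ((w' j + 1 : ℕ) * ε) < u j} = (⋂ j, {u | u j ≤ ψ (w' j * ε)}) ∩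
            ⋂ j ∈ T, {u | ψ ((w' j + 1 : ℕ) * ε) < u j} := by
        ext u; simp
      rw [this]
      exact (MeasurableSet.iInter fun j => measurableSet_le (measurable_pi_apply j)
        measurable_const).inter (T.measurableSet_biInter fun j _ =>
          measurableSet_lt measurable_const (measurable_pi_apply j))
    rw [hset, measureReal_sdiff hsub hmeas, ih, ih, hsum, Finset.card_insert_of_notMem hi]
    rfl

theorem Copula.iterDiff_nonneg {n : ℕ} (C : Copula (n + 1)) {ψ : ℝ≥0 → I} (hψ : Antitone ψ)
    (hC : ∀ z : Fin (n + 1) → ℝ≥0, C (fun i => ψ (z i)) = ψ (∑ i, z i)) (ε : ℝ≥0) {k : ℕ}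
    (hk : k ≤ n + 1) (j : ℕ) : 0 ≤ iterDiff (fun j => (ψ (j * ε) : ℝ)) k j := by
  obtain ⟨T, -, rfl⟩ := Finset.exists_subset_card_eq
    (s := (Finset.univ : Finset (Fin (n + 1)))) (n := k) (by simpa using hk)
  have := C.measure_real_box hψ hC ε T (Pi.single 0 j)
  rw [Finset.sum_pi_single'] at this
  simp only [Finset.mem_univ, if_true] at this
  rw [← this]
  exact measureReal_nonneg

/-! ### Discrete Williamson representation of multiply monotone sequences -/

section DiscreteWilliamson

variable {a : ℕ → ℝ}

theorem tendsto_iterDiff (h0 : Filter.Tendsto a Filter.atTop (𝓝 0)) (k : ℕ) :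
    Filter.Tendsto (iterDiff a k) Filter.atTop (𝓝 0) := by
  induction k with
  | zero => exact h0
  | succ k ih =>
    have := ih.sub (ih.comp (Filter.tendsto_add_atTop_nat 1))
    rw [sub_zero] at this
    exact this

theorem ofReal_iterDiff_eq_tsum (h0 : Filter.Tendsto a Filter.atTop (𝓝 0)) {k : ℕ}
    (hk : ∀ j, 0 ≤ iterDiff a (k + 1) j) (j : ℕ) :
    ENNReal.ofReal (iterDiff a k j) = ∑' m, ENNReal.ofReal (iterDiff a (k + 1) (j + m)) := by
  have hs : HasSum (fun m => iterDiff a (k + 1) (j + m)) (iterDiff a k j) := by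
    rw [hasSum_iff_tendsto_nat_of_nonneg fun m => hk _]
    have : ∀ N, ∑ m ∈ Finset.range N, iterDiff a (k + 1) (j + m) =
        iterDiff a k j - iterDiff a k (j + N) := fun N => by
      simpa [iterDiff, add_assoc] using Finset.sum_range_sub' (fun m => iterDiff a k (j + m)) N
    simp only [this]
    have h1 := (tendsto_iterDiff h0 k).comp (Filter.tendsto_add_atTop_nat j)
    simpa [Function.comp_def, add_comm] using h1.const_sub (iterDiff a k j)
  rw [← hs.tsum_eq, ENNReal.ofReal_tsum_of_nonneg (fun m => hk _) hs.summable]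

/-- Each difference of order n + 1 is itself a telescoping sum of differences of order n + 2.
Grouping the double series along antidiagonals, which is unconditional in `ℝ≥0∞`, raises the
binomial coefficient by the hockey-stick identity. -/
theorem ofReal_eq_tsum_choose (h0 : Filter.Tendsto a Filter.atTop (𝓝 0)) {n : ℕ}
    (hn : ∀ k ≤ n + 1, ∀ j, 0 ≤ iterDiff a k j) (j : ℕ) :
    ENNReal.ofReal (a j) =
      ∑' m, ((m + n).choose n : ℝ≥0∞) * ENNReal.ofReal (iterDiff a (n + 1) (j + m)) := by
  induction n with
  | zero => simpa [iterDiff] using ofReal_iterDiff_eq_tsum (k := 0) h0 (hn 1 le_rfl) j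
  | succ n ih =>
    rw [ih fun k hk => hn k (by omega)]
    simp only [fun m => ofReal_iterDiff_eq_tsum (k := n + 1) h0 (hn _ le_rfl) (j + m),
      ← ENNReal.tsum_mul_left]
    rw [← ENNReal.tsum_prod (f := fun m l => ((m + n).choose n : ℝ≥0∞) *
        ENNReal.ofReal (iterDiff a (n + 1 + 1) (j + m + l))),
      ← Finset.HasAntidiagonal.sigmaAntidiagonalEquivProd.tsum_eq, ENNReal.tsum_sigma']
    refine tsum_congr fun N => ?_
    have hN : (N + (n + 1)).choose (n + 1) =
        ∑ p ∈ Finset.HasAntidiagonal.antidiagonal N, (p.1 + n).choose n := by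
      rw [Finset.Nat.sum_antidiagonal_eq_sum_range_succ_mk, ← Nat.add_assoc,
        ← Nat.sum_range_add_choose]
    rw [tsum_fintype, hN, Nat.cast_sum, Finset.sum_mul]
    refine Eq.trans (Finset.sum_congr rfl fun p _ => ?_) (Finset.sum_coe_sort
      (Finset.HasAntidiagonal.antidiagonal N) fun p : ℕ × ℕ => ((p.1 + n).choose n : ℝ≥0∞) *
        ENNReal.ofReal (iterDiff a (n + 1 + 1) (j + N)))
    have := Finset.HasAntidiagonal.mem_antidiagonal.1 p.2
    simp [Finset.HasAntidiagonal.sigmaAntidiagonalEquivProd, ← this, add_assoc]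

/-- The discrete Williamson representation of an `(n + 1)`-monotone sequence. -/
theorem hasSum_choose_iterDiff (h0 : Filter.Tendsto a Filter.atTop (𝓝 0)) {n : ℕ}
    (hn : ∀ k ≤ n + 1, ∀ j, 0 ≤ iterDiff a k j) (j : ℕ) :
    HasSum (fun m => ((m + n).choose n : ℝ) * iterDiff a (n + 1) (j + m)) (a j) := by
  have hnn : ∀ m, 0 ≤ ((m + n).choose n : ℝ) * iterDiff a (n + 1) (j + m) := fun m =>
    mul_nonneg (Nat.cast_nonneg _) (hn _ le_rfl _)
  have h := ofReal_eq_tsum_choose h0 hn j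
  have h' : ENNReal.ofReal (a j) =
      ∑' m, ENNReal.ofReal (((m + n).choose n : ℝ) * iterDiff a (n + 1) (j + m)) := by
    rw [h]
    refine tsum_congr fun m => ?_
    rw [ENNReal.ofReal_mul (Nat.cast_nonneg _), ENNReal.ofReal_natCast]
  have hs : Summable fun m => ((m + n).choose n : ℝ) * iterDiff a (n + 1) (j + m) := by
    have := ENNReal.summable_toReal (h' ▸ ENNReal.ofReal_ne_top)
    refine this.congr fun m => ENNReal.toReal_ofReal (hnn m)
  rw [← ENNReal.ofReal_tsum_of_nonneg hnn hs,
    ENNReal.ofReal_eq_ofReal_iff (show 0 ≤ a j from hn 0 (by omega) j) (tsum_nonneg hnn)] at h'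
  exact h' ▸ hs.hasSum

end DiscreteWilliamson

/-! ### Estimates for the Williamson kernel -/

/-- The kernel `(1 - s / r)_+ ^ n` of the Williamson `(n + 1)`-transform. -/
noncomputable def williamsonKernel (n : ℕ) (s r : ℝ) : ℝ := max 0 (1 - s / r) ^ n

section WilliamsonKernel

variable {n : ℕ} {s s' r r' : ℝ}

theorem williamsonKernel_nonneg : 0 ≤ williamsonKernel n s r := by
  unfold williamsonKernel; positivity

theorem williamsonKernel_le_one (hs : 0 ≤ s) (hr : 0 < r) : williamsonKernel n s r ≤ 1 :=
  pow_le_one₀ (le_max_left _ _) (max_le zero_le_one (by have := div_nonneg hs hr.le; linarith))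

theorem williamsonKernel_zero_left : williamsonKernel n 0 r = 1 := by simp [williamsonKernel]

theorem williamsonKernel_eq_zero (hn : n ≠ 0) (hr : 0 < r) (h : r ≤ s) :
    williamsonKernel n s r = 0 := by
  have : 1 - s / r ≤ 0 := by rw [sub_nonpos, one_le_div hr]; exact h
  simp [williamsonKernel, max_eq_left this, hn]

theorem williamsonKernel_anti (hr : 0 < r) (h : s ≤ s') :
    williamsonKernel n s' r ≤ williamsonKernel n s r := by
  unfold williamsonKernel
  gcongr

theorem williamsonKernel_strictAnti (hn : n ≠ 0) (hr : 0 < r) (hsr : s < r) (h : s < s') :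
    williamsonKernel n s' r < williamsonKernel n s r := by
  have h0 : 0 < 1 - s / r := by rw [sub_pos, div_lt_one hr]; exact hsr
  refine pow_lt_pow_left₀ ?_ (le_max_left _ _) hn
  rw [max_eq_right h0.le]
  exact max_lt h0 (by gcongr)

theorem pow_sub_pow_le {x y : ℝ} (hx : 0 ≤ x) (hxy : x ≤ y) (hy : y ≤ 1) (n : ℕ) :
    y ^ n - x ^ n ≤ n * (y - x) := by
  induction n with
  | zero => simp
  | succ n ih =>
    have h1 : y ^ n ≤ 1 := pow_le_one₀ (hx.trans hxy) hy
    have h2 : x ^ n ≤ y ^ n := by gcongr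
    have : y ^ (n + 1) - x ^ (n + 1) = y ^ n * (y - x) + x * (y ^ n - x ^ n) := by ring
    rw [this]
    push_cast
    nlinarith [mul_le_mul_of_nonneg_right h1 (sub_nonneg.2 hxy),
      mul_le_mul_of_nonneg_right (hxy.trans hy) (sub_nonneg.2 h2)]

/-- The power is n-Lipschitz on [0,1], and its base changes most when r = s'. The bound is free of
r, so it passes to the transform of any γ. -/
theorem williamsonKernel_sub_le (hs : 0 ≤ s) (hr : 0 < r) (h : s ≤ s') (hs' : 0 < s') :
    williamsonKernel n s r - williamsonKernel n s' r ≤ n * ((s' - s) / s') := by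
  have hsr := div_nonneg hs hr.le
  have hss : s / r ≤ s' / r := by gcongr
  refine (pow_sub_pow_le (le_max_left _ _) (max_le_max le_rfl (by linarith))
    (max_le zero_le_one (by linarith)) n).trans ?_
  refine mul_le_mul_of_nonneg_left ?_ (Nat.cast_nonneg _)
  have h0 : 0 ≤ (s' - s) / s' := div_nonneg (by linarith) hs'.le
  rcases le_total r s' with h1 | h1
  · have : 1 ≤ s' / r := (one_le_div hr).2 h1
    rw [max_eq_left (a := (0 : ℝ)) (b := 1 - s' / r) (by linarith), sub_zero]
    refine max_le h0 ?_
    rw [sub_div, div_self hs'.ne']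
    have : s / s' ≤ s / r := by gcongr
    linarith
  · have : s' / r ≤ 1 := (div_le_one hr).2 h1
    rw [max_eq_right (by linarith), max_eq_right (by linarith)]
    have : (s' - s) / r ≤ (s' - s) / s' := by
      have := sub_nonneg.2 h
      gcongr
    have h2 : (s' - s) / r = s' / r - s / r := sub_div _ _ _
    linarith

/-- Scaling r by w amounts to dividing s by w. The previous estimate sees only the relative change
of s, so the bound is uniform in both s and r. -/
theorem williamsonKernel_scale (hs : 0 ≤ s) (hr : 0 < r) {w δ : ℝ} (hw : w ∈ Set.Icc 1 (1 + δ)) :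
    |williamsonKernel n s (r * w) - williamsonKernel n s r| ≤ n * δ := by
  obtain ⟨h1, h2⟩ := hw
  have hw0 : 0 < w := by linarith
  have : williamsonKernel n s (r * w) = williamsonKernel n (s / w) r := by
    unfold williamsonKernel; congr 3; field_simp
  have hle : s / w ≤ s := div_le_self hs h1
  rw [this, abs_of_nonneg (sub_nonneg.2 (williamsonKernel_anti hr hle))]
  rcases hs.eq_or_lt with rfl | hs0
  · simp only [zero_div, sub_self]
    exact mul_nonneg (Nat.cast_nonneg _) (by linarith)
  refine (williamsonKernel_sub_le (by positivity) hr hle hs0).trans ?_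
  refine mul_le_mul_of_nonneg_left ?_ (Nat.cast_nonneg _)
  have : (s - s / w) / s = 1 - 1 / w := by field_simp
  rw [this]
  have h3 : 1 - 1 / w = (w - 1) / w := by field_simp
  rw [h3]
  exact (div_le_self (by linarith) h1).trans (by linarith)

theorem continuous_williamsonKernel : Continuous fun s => williamsonKernel n s r := by
  unfold williamsonKernel; fun_prop

end WilliamsonKernel

/-! ### Approximating generators by discrete Williamson transforms -/

/-- The ratio is the product of 1 - j/(k+1+i) over 0 ≤ i < n. Each factor lies in [0,1] and exceeds
1 - j/(k+1) by at most i/(k+1); these errors sum to at most n²/(k+1). -/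
theorem abs_choose_div_sub_le {j k : ℕ} (h : j ≤ k) (n : ℕ) :
    ((k - j + n).choose n : ℝ) / (k + n).choose n ≤ 1 ∧
    |((k - j + n).choose n : ℝ) / (k + n).choose n - (1 - (j : ℝ) / (k + 1)) ^ n| ≤
      n ^ 2 / (k + 1) := by
  have hj : (j : ℝ) ≤ k := by exact_mod_cast h
  have hcast : ((k - j : ℕ) : ℝ) = k - j := by push_cast [h]; ring
  have hk : (0 : ℝ) < k + 1 := by positivity
  set p : ℝ := 1 - (j : ℝ) / (k + 1) with hp
  have hp0 : 0 ≤ p := by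
    rw [hp, sub_nonneg, div_le_one hk]; linarith
  have hp1 : p ≤ 1 := by
    rw [hp]; have : 0 ≤ (j : ℝ) / (k + 1) := by positivity
    linarith
  have key : ∀ n : ℕ, p ^ n ≤ ((k - j + n).choose n : ℝ) / (k + n).choose n ∧
      ((k - j + n).choose n : ℝ) / (k + n).choose n ≤ 1 ∧
      ((k - j + n).choose n : ℝ) / (k + n).choose n - p ^ n ≤ n ^ 2 / (k + 1) := by
    intro n
    induction n with
    | zero => simp
    | succ n ih =>
      set q := ((k - j + n).choose n : ℝ) / (k + n).choose n with hq
      set t : ℝ := 1 - (j : ℝ) / (k + 1 + n) with ht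
      have hrec : ∀ m : ℕ, ((m + (n + 1)).choose (n + 1) : ℝ) =
          (m + n).choose n * ((m + n + 1) / (n + 1)) := by
        intro m
        have := Nat.add_one_mul_choose_eq (m + n) n
        have h2 : ((m + n + 1 : ℕ) : ℝ) * (m + n).choose n =
            (m + (n + 1)).choose (n + 1) * (n + 1 : ℕ) := by exact_mod_cast this
        push_cast at h2
        field_simp
        linarith
      have hq' : ((k - j + (n + 1)).choose (n + 1) : ℝ) / (k + (n + 1)).choose (n + 1) =
          q * t := by
        rw [hrec, hrec, hq, ht, hcast]
        have : ((k + n).choose n : ℝ) ≠ 0 := by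
          exact_mod_cast (Nat.choose_pos (by omega)).ne'
        have h3 : (k : ℝ) + n + 1 ≠ 0 := by positivity
        have h4 : (k : ℝ) + 1 + n ≠ 0 := by positivity
        field_simp
        ring
      have hpt : p ≤ t := by
        rw [hp, ht]
        exact sub_le_sub_left (div_le_div_of_nonneg_left (Nat.cast_nonneg _) hk
          (by linarith [(Nat.cast_nonneg n : (0 : ℝ) ≤ n)])) _
      have ht1 : t ≤ 1 := by
        rw [ht]; have : 0 ≤ (j : ℝ) / (k + 1 + n) := by positivity
        linarith
      have htp : t - p ≤ n / (k + 1) := by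
        have h4 : (0 : ℝ) < (k : ℝ) + 1 + n := by positivity
        have : t - p = (n / (k + 1)) * (j / (k + 1 + n)) := by
          rw [hp, ht]; field_simp; ring
        rw [this]
        refine mul_le_of_le_one_right (by positivity) ?_
        rw [div_le_one h4]; linarith [(Nat.cast_nonneg n : (0 : ℝ) ≤ n)]
      obtain ⟨i1, i2, i3⟩ := ih
      have hq0 : 0 ≤ q := by positivity
      have hpn : 0 ≤ p ^ n := by positivity
      rw [hq', pow_succ]
      refine ⟨by gcongr, mul_le_one₀ i2 (hp0.trans hpt) ht1, ?_⟩
      have e : q * t - p ^ n * p = q * (t - p) + p * (q - p ^ n) := by ring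
      have e1 : q * (t - p) ≤ n / (k + 1) :=
        (mul_le_of_le_one_left (by linarith) i2).trans htp
      have e2 : p * (q - p ^ n) ≤ n ^ 2 / (k + 1) :=
        (mul_le_of_le_one_left (by linarith) hp1).trans i3
      rw [e]
      have e3 : (n : ℝ) / (k + 1) + n ^ 2 / (k + 1) ≤ ((n + 1 : ℕ) : ℝ) ^ 2 / (k + 1) := by
        rw [← add_div]; push_cast; gcongr; nlinarith [(Nat.cast_nonneg n : (0 : ℝ) ≤ n)]
      linarith
  obtain ⟨h1, h2, h3⟩ := key n
  exact ⟨h2, by rwa [abs_of_nonneg (by linarith)]⟩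

/-- Quantitative comparison on the grid `ε ℕ` of an `(n + 1)`-monotone sequence with the
Williamson transform of its discrete Williamson measure. -/
theorem exists_weights_grid {a : ℕ → ℝ} (h0 : Filter.Tendsto a Filter.atTop (𝓝 0)) (ha : a 0 = 1)
    {n : ℕ} (hn0 : n ≠ 0) (hn : ∀ k ≤ n + 1, ∀ j, 0 ≤ iterDiff a k j) :
    ∃ W : ℕ → ℝ, (∀ k, 0 ≤ W k) ∧ HasSum W 1 ∧ ∀ K j : ℕ,
      |a j - ∑' k, W k * williamsonKernel n j (k + 1)| ≤ n ^ 2 / (K + 1) + (1 - a K) := by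
  have hD : ∀ k, 0 ≤ iterDiff a (n + 1) k := hn _ le_rfl
  set W : ℕ → ℝ := fun k => (k + n).choose n * iterDiff a (n + 1) k with hW
  have hW0 : ∀ k, 0 ≤ W k := fun k => mul_nonneg (Nat.cast_nonneg _) (hD k)
  have hW1 : HasSum W 1 := by
    have := hasSum_choose_iterDiff h0 hn 0
    simpa [ha, W] using this
  -- The discrete analogue of the kernel: shifting the index of the discrete representation by j
  -- turns it into a_j = ∑ W_k q(j,k).
  set q : ℕ → ℕ → ℝ := fun j k =>
    if k < j then 0 else ((k - j + n).choose n : ℝ) / (k + n).choose n with hq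
  have hqsum : ∀ j, HasSum (fun k => W k * q j k) (a j) := by
    intro j
    rw [← hasSum_nat_add_iff' j, Finset.sum_eq_zero, sub_zero]
    · refine (hasSum_choose_iterDiff h0 hn j).congr_fun fun m => ?_
      have : ((m + j + n).choose n : ℝ) ≠ 0 := by
        exact_mod_cast (Nat.choose_pos (by omega)).ne'
      simp only [hW, hq, if_neg (show ¬ m + j < j by omega), Nat.add_sub_cancel, add_comm j m]
      field_simp
    · intro k hk
      simp [hq, Finset.mem_range.1 hk]
  have hp01 : ∀ j k : ℕ, williamsonKernel n j (k + 1) ≤ 1 := fun j k =>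
    williamsonKernel_le_one (Nat.cast_nonneg _) (by positivity)
  have hq0 : ∀ j k, 0 ≤ q j k := fun j k => by
    simp only [hq]; split_ifs <;> positivity
  have hq1 : ∀ j k, q j k ≤ 1 := fun j k => by
    simp only [hq]; split_ifs with h
    · exact zero_le_one
    · exact (abs_choose_div_sub_le (not_lt.1 h) n).1
  have hpsum : ∀ j : ℕ, Summable fun k : ℕ => W k * williamsonKernel n j (k + 1) := fun j =>
    Summable.of_nonneg_of_le (fun k => mul_nonneg (hW0 k) williamsonKernel_nonneg)
      (fun k => mul_le_of_le_one_right (hW0 k) (hp01 j k)) hW1.summable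
  refine ⟨W, hW0, hW1, fun K j => ?_⟩
  -- For j ≤ k the binomial estimate is good only when k is large. For k < K the difference is at
  -- most 1 = 1 - q(K,k), and averaging 1 - q(K,k) against W gives exactly 1 - a_K.
  have hbound : ∀ k, |q j k - williamsonKernel n j (k + 1)| ≤
      n ^ 2 / (K + 1) + (1 - q K k) := by
    intro k
    by_cases hkj : k < j
    · have : williamsonKernel n j (k + 1) = 0 :=
        williamsonKernel_eq_zero hn0 (by positivity) (by exact_mod_cast hkj)
      simp only [this, hq, if_pos hkj, sub_zero, abs_zero]
      have := hq1 K k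
      simp only [hq] at this
      have h3 : (0 : ℝ) ≤ n ^ 2 / (K + 1) := by positivity
      linarith
    by_cases hkK : k < K
    · have h1 := hq0 j k
      have h2 := hq1 j k
      have h3 := hp01 j k
      have h4 := williamsonKernel_nonneg (n := n) (s := j) (r := (k : ℝ) + 1)
      have h5 : q K k = 0 := by simp [hq, hkK]
      have h6 : (0 : ℝ) ≤ n ^ 2 / (K + 1) := by positivity
      rw [h5, abs_le]; constructor <;> linarith
    · have h1 := (abs_choose_div_sub_le (not_lt.1 hkj) n).2
      have h2 : williamsonKernel n j (k + 1) = (1 - (j : ℝ) / (k + 1)) ^ n := by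
        have : (0 : ℝ) ≤ 1 - (j : ℝ) / (k + 1) := by
          rw [sub_nonneg, div_le_one (by positivity)]
          have : (j : ℝ) ≤ k := by exact_mod_cast not_lt.1 hkj
          linarith
        rw [williamsonKernel, max_eq_right this]
      have h3 : (n : ℝ) ^ 2 / (k + 1) ≤ n ^ 2 / (K + 1) := by
        have : (K : ℝ) ≤ k := by exact_mod_cast not_lt.1 hkK
        gcongr
      have h4 := hq1 K k
      have h5 : q j k = ((k - j + n).choose n : ℝ) / (k + n).choose n := by simp [hq, hkj]
      rw [h2, h5]
      linarith
  have hR : HasSum (fun k => W k * (n ^ 2 / (K + 1) + (1 - q K k)))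
      (n ^ 2 / (K + 1) + (1 - a K)) := by
    have := ((hW1.mul_right ((n : ℝ) ^ 2 / (K + 1))).add (hW1.sub (hqsum K)))
    rw [one_mul] at this
    exact this.congr_fun fun k => by ring
  have hL := (hqsum j).sub (hpsum j).hasSum
  rw [← hL.tsum_eq, ← hR.tsum_eq, ← Real.norm_eq_abs]
  refine tsum_of_norm_bounded hR.summable.hasSum fun k => ?_
  rw [← mul_sub, Real.norm_eq_abs, abs_mul, abs_of_nonneg (hW0 k)]
  exact mul_le_mul_of_nonneg_left (hbound k) (hW0 k)

/-- Every `(n + 1)`-monotone Archimedean generator is uniformly close to the Williamson transform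
of a discrete probability measure. -/
theorem IsGenerator.exists_weights {ψ : ℝ≥0 → I} (hψ : IsGenerator ψ) {n : ℕ} (hn0 : n ≠ 0)
    (hn : ∀ ε : ℝ≥0, ∀ k ≤ n + 1, ∀ j, 0 ≤ iterDiff (fun j => (ψ (j * ε) : ℝ)) k j)
    {η : ℝ} (hη : 0 < η) :
    ∃ (W : ℕ → ℝ) (ε : ℝ), 0 < ε ∧ (∀ k, 0 ≤ W k) ∧ HasSum W 1 ∧ ∀ s : ℝ≥0,
      |(ψ s : ℝ) - ∑' k : ℕ, W k * williamsonKernel n s ((k + 1) * ε)| ≤ η := by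
  -- K controls the binomial error, and then ε, depending on K, controls both 1 - a_K and the
  -- oscillation of ψ over one mesh. Each of the three errors takes η/3.
  obtain ⟨K, hK⟩ : ∃ K : ℕ, (n : ℝ) ^ 2 / (K + 1) < η / 3 := by
    obtain ⟨K, hK⟩ := exists_nat_gt ((n : ℝ) ^ 2 / (η / 3))
    refine ⟨K, ?_⟩
    rw [div_lt_iff₀ (by positivity)] at hK ⊢
    nlinarith
  obtain ⟨ε, hε, hεK⟩ : ∃ ε : ℝ≥0, 0 < ε ∧ 1 - (ψ ((K + 1) * ε) : ℝ) < η / 3 := by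
    have h1 : Filter.Tendsto (fun ε : ℝ≥0 => 1 - (ψ ((K + 1) * ε) : ℝ)) (𝓝[>] 0) (𝓝 0) := by
      have hc : Continuous fun ε : ℝ≥0 => 1 - (ψ ((K + 1) * ε) : ℝ) := by
        have := hψ.continuous
        fun_prop
      have := hc.tendsto 0
      simp only [mul_zero, hψ.map_zero, Set.Icc.coe_one, sub_self] at this
      exact this.mono_left nhdsWithin_le_nhds
    obtain ⟨ε, h1, h2⟩ :=
      ((h1.eventually (gt_mem_nhds (by positivity : 0 < η / 3))).and self_mem_nhdsWithin).exists
    exact ⟨ε, h2, h1⟩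
  set a : ℕ → ℝ := fun j => (ψ (j * ε) : ℝ) with ha
  have hε' : (0 : ℝ) < ε := hε
  have h0 : Filter.Tendsto a Filter.atTop (𝓝 0) := by
    have h2 : Filter.Tendsto (fun j : ℕ => (j : ℝ≥0) * ε) Filter.atTop Filter.atTop :=
      Filter.Tendsto.atTop_mul_const hε tendsto_natCast_atTop_atTop
    have := (continuous_subtype_val.tendsto (0 : I)).comp (hψ.tendsto_zero.comp h2)
    exact this
  have ha0 : a 0 = 1 := by simp [ha, hψ.map_zero]
  have hamono : Antitone a := fun i j hij => hψ.antitone (by gcongr)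
  obtain ⟨W, hW0, hW1, hW⟩ := exists_weights_grid h0 ha0 hn0 (hn ε)
  refine ⟨W, ε, hε', hW0, hW1, fun s => ?_⟩
  have hgrid : ∀ j : ℕ, ∑' k : ℕ, W k * williamsonKernel n j (k + 1) =
      ∑' k : ℕ, W k * williamsonKernel n (j * ε) ((k + 1) * ε) := fun j => by
    refine tsum_congr fun k => ?_
    unfold williamsonKernel
    rw [mul_div_mul_right _ _ hε'.ne']
  have hsum : ∀ s : ℝ, 0 ≤ s → Summable fun k : ℕ => W k * williamsonKernel n s ((k + 1) * ε) :=
    fun s hs => Summable.of_nonneg_of_le (fun k => mul_nonneg (hW0 k) williamsonKernel_nonneg)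
      (fun k => mul_le_of_le_one_right (hW0 k) (williamsonKernel_le_one hs (by positivity)))
      hW1.summable
  have hanti : ∀ s s' : ℝ, 0 ≤ s → s ≤ s' →
      ∑' k : ℕ, W k * williamsonKernel n s' ((k + 1) * ε) ≤
        ∑' k : ℕ, W k * williamsonKernel n s ((k + 1) * ε) := fun s s' hs h =>
    (hsum s' (hs.trans h)).tsum_le_tsum (fun k => mul_le_mul_of_nonneg_left
      (williamsonKernel_anti (by positivity) h) (hW0 k)) (hsum s hs)
  -- Nonnegative second differences mean convexity, so the first grid step is the steepest.
  have hstep : ∀ j, a j - a (j + 1) ≤ 1 - a 1 := by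
    intro j
    induction j with
    | zero => rw [ha0]
    | succ j ih =>
      have := hn ε 2 (by omega) j
      simp only [iterDiff] at this
      linarith
  set j : ℕ := ⌊(s : ℝ) / ε⌋₊ with hj
  have hj1 : (j : ℝ) * ε ≤ s := by
    have := Nat.floor_le (div_nonneg s.2 hε'.le : (0 : ℝ) ≤ (s : ℝ) / ε)
    rwa [le_div_iff₀ hε'] at this
  have hj2 : (s : ℝ) ≤ ((j + 1 : ℕ) : ℝ) * ε := by
    have := (Nat.lt_floor_add_one ((s : ℝ) / ε)).le
    rw [div_le_iff₀ hε'] at this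
    exact_mod_cast this
  have hψ1 : (ψ s : ℝ) ≤ a j := hψ.antitone (show (j : ℝ≥0) * ε ≤ s by exact_mod_cast hj1)
  have hψ2 : a (j + 1) ≤ (ψ s : ℝ) :=
    hψ.antitone (show s ≤ ((j + 1 : ℕ) : ℝ≥0) * ε by exact_mod_cast hj2)
  have hS1 := hanti _ _ (by positivity) hj1
  have hS2 := hanti s _ s.coe_nonneg hj2
  have hg1 := abs_sub_le_iff.1 (hW K j)
  have hg2 := abs_sub_le_iff.1 (hW K (j + 1))
  rw [hgrid] at hg1 hg2
  have hK1 : 1 - a K < η / 3 :=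
    lt_of_le_of_lt (by
      have := hamono (Nat.le_succ K)
      simp only [ha] at this ⊢
      push_cast at this
      linarith) hεK
  have h11 : 1 - a 1 < η / 3 :=
    lt_of_le_of_lt (by
      have := hamono (show 1 ≤ K + 1 by omega)
      simp only [ha] at this ⊢
      push_cast at this ⊢
      linarith) hεK
  have := hstep j
  generalize ∑' k : ℕ, W k * williamsonKernel n s ((k + 1) * ε) = S at *
  generalize ∑' k : ℕ, W k * williamsonKernel n (j * ε) ((k + 1) * ε) = S1 at *
  generalize ∑' k : ℕ, W k * williamsonKernel n ((j + 1 : ℕ) * ε) ((k + 1) * ε) = S2 at *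
  generalize (n : ℝ) ^ 2 / (K + 1) = c at *
  rw [abs_sub_le_iff]
  constructor <;> linarith [hg1.1, hg1.2, hg2.1, hg2.2]

/-! ### Williamson transforms are Archimedean generators -/

/-- The Williamson `(n + 1)`-transform `s ↦ ∫ (1 - s / r)_+ ^ n dγ(r)`. -/
noncomputable def williamson (n : ℕ) (γ : Measure ℝ) (s : ℝ) : ℝ := ∫ r, williamsonKernel n s r ∂γ

/-- The Williamson transform as a map `[0,∞) → [0,1]`. -/
noncomputable def williamsonGenerator (n : ℕ) (γ : Measure ℝ) (s : ℝ≥0) : I :=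
  Set.projIcc 0 1 zero_le_one (williamson n γ s)

section Williamson

variable {n : ℕ} {γ : Measure ℝ}

@[fun_prop]
theorem measurable_williamsonKernel_right (s : ℝ) : Measurable (williamsonKernel n s) := by
  unfold williamsonKernel; fun_prop

theorem williamson_nonneg (s : ℝ) : 0 ≤ williamson n γ s :=
  integral_nonneg fun _ => williamsonKernel_nonneg

variable [IsProbabilityMeasure γ]

theorem integrable_williamsonKernel (hγ : ∀ᵐ r ∂γ, 0 < r) {s : ℝ} (hs : 0 ≤ s) :
    Integrable (williamsonKernel n s) γ := by
  refine (integrable_const (1 : ℝ)).mono' (by fun_prop) ?_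
  filter_upwards [hγ] with r hr
  rw [Real.norm_of_nonneg williamsonKernel_nonneg]
  exact williamsonKernel_le_one hs hr

theorem williamson_zero : williamson n γ 0 = 1 := by
  simp [williamson, williamsonKernel_zero_left]

theorem williamson_anti (hγ : ∀ᵐ r ∂γ, 0 < r) {s s' : ℝ} (hs : 0 ≤ s) (h : s ≤ s') :
    williamson n γ s' ≤ williamson n γ s :=
  integral_mono_ae (integrable_williamsonKernel hγ (hs.trans h)) (integrable_williamsonKernel hγ hs)
    (by filter_upwards [hγ] with r hr using williamsonKernel_anti hr h)

theorem coe_williamsonGenerator (hγ : ∀ᵐ r ∂γ, 0 < r) (s : ℝ≥0) :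
    (williamsonGenerator n γ s : ℝ) = williamson n γ s := by
  have : williamson n γ s ∈ Set.Icc (0 : ℝ) 1 :=
    ⟨williamson_nonneg _, (williamson_anti hγ le_rfl s.coe_nonneg).trans williamson_zero.le⟩
  rw [williamsonGenerator, Set.projIcc_of_mem _ this]

theorem williamson_sub_le (hγ : ∀ᵐ r ∂γ, 0 < r) {s s' : ℝ} (hs : 0 ≤ s) (h : s ≤ s')
    (hs' : 0 < s') : williamson n γ s - williamson n γ s' ≤ n * ((s' - s) / s') := by
  unfold williamson
  rw [← integral_sub (integrable_williamsonKernel hγ hs)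
    (integrable_williamsonKernel hγ hs'.le)]
  refine (integral_mono_ae ((integrable_williamsonKernel hγ hs).sub
    (integrable_williamsonKernel hγ hs'.le)) (integrable_const ((n : ℝ) * ((s' - s) / s')))
    (by filter_upwards [hγ] with r hr using williamsonKernel_sub_le hs hr h hs')).trans ?_
  simp

/-- Equality of the transforms would force equality of the kernels at γ-almost every r. The kernel
is strictly decreasing wherever it is nonzero, so it would vanish almost everywhere. -/
theorem williamson_strictAnti (hn : n ≠ 0) (hγ : ∀ᵐ r ∂γ, 0 < r) {s s' : ℝ} (hs : 0 ≤ s)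
    (h : s < s') (h0 : williamson n γ s ≠ 0) : williamson n γ s' < williamson n γ s := by
  refine lt_of_le_of_ne (williamson_anti hγ hs h.le) fun heq => h0 ?_
  have h1 := integrable_williamsonKernel (n := n) hγ hs
  have h2 := integrable_williamsonKernel (n := n) hγ (hs.trans h.le)
  have hint : ∫ r, (williamsonKernel n s - williamsonKernel n s') r ∂γ = 0 := by
    rw [integral_sub' h1 h2]; exact sub_eq_zero.2 heq.symm
  rw [integral_eq_zero_iff_of_nonneg_ae
    (by filter_upwards [hγ] with r hr using sub_nonneg.2 (williamsonKernel_anti hr h.le))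
    (h1.sub h2)] at hint
  refine integral_eq_zero_of_ae ?_
  filter_upwards [hγ, hint] with r hr h
  by_contra hne
  have hsr : s < r := by
    by_contra! hrs
    exact hne (williamsonKernel_eq_zero hn hr hrs)
  exact (williamsonKernel_strictAnti hn hr hsr ‹s < s'›).ne' (sub_eq_zero.1 h)

theorem continuous_williamson (hγ : ∀ᵐ r ∂γ, 0 < r) :
    Continuous fun s : ℝ≥0 => williamson n γ s := by
  refine continuous_of_dominated (bound := fun _ => 1) (fun s => by fun_prop) (fun s => ?_)
    (integrable_const _) (ae_of_all _ fun r =>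
      continuous_williamsonKernel.comp NNReal.continuous_coe)
  filter_upwards [hγ] with r hr
  rw [Real.norm_of_nonneg williamsonKernel_nonneg]
  exact williamsonKernel_le_one s.coe_nonneg hr

theorem tendsto_williamson (hn : n ≠ 0) (hγ : ∀ᵐ r ∂γ, 0 < r) :
    Filter.Tendsto (fun s : ℝ≥0 => williamson n γ s) Filter.atTop (𝓝 0) := by
  have := tendsto_integral_filter_of_dominated_convergence (μ := γ) (l := Filter.atTop)
    (F := fun (s : ℝ≥0) r => williamsonKernel n s r) (f := fun _ => 0) (fun _ => 1)
    (Filter.Eventually.of_forall fun s => by fun_prop)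
    (Filter.Eventually.of_forall fun s => ?_) (integrable_const _) ?_
  · rw [integral_zero] at this
    exact this
  · filter_upwards [hγ] with r hr
    rw [Real.norm_of_nonneg williamsonKernel_nonneg]
    exact williamsonKernel_le_one s.coe_nonneg hr
  · filter_upwards [hγ] with r hr
    refine tendsto_const_nhds.congr' ?_
    filter_upwards [Filter.eventually_ge_atTop r.toNNReal] with s hs
    exact (williamsonKernel_eq_zero hn hr (Real.toNNReal_le_iff_le_coe.1 hs)).symm

theorem isGenerator_williamson (hn : n ≠ 0) (hγ : ∀ᵐ r ∂γ, 0 < r) :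
    IsGenerator (williamsonGenerator n γ) where
  continuous := continuous_projIcc.comp (continuous_williamson hγ)
  antitone a b hab := Set.monotone_projIcc _ (williamson_anti hγ a.coe_nonneg hab)
  map_zero := by
    ext
    rw [coe_williamsonGenerator hγ, NNReal.coe_zero, williamson_zero, Set.Icc.coe_one]
  tendsto_zero := by
    rw [tendsto_subtype_rng]
    simp only [coe_williamsonGenerator hγ]
    exact tendsto_williamson hn hγ
  strictAntiOn := by
    rintro a - b ⟨-, hb⟩ hab
    have ha : generatorExt (williamsonGenerator n γ) a ≠ 0 := fun h =>
      absurd (sInf_le (show a ∈ {z | generatorExt (williamsonGenerator n γ) z = 0} from h))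
        (not_le.2 (hab.trans_le hb))
    have ha' : a ≠ ∞ := (hab.trans_le le_top).ne
    by_cases hb' : b = ∞
    · rw [show generatorExt (williamsonGenerator n γ) b = 0 by simp [generatorExt, hb']]
      exact bot_lt_iff_ne_bot.2 ha
    · rw [generatorExt, if_neg ha'] at ha
      rw [generatorExt, generatorExt, if_neg ha', if_neg hb', ← Subtype.coe_lt_coe,
        coe_williamsonGenerator hγ, coe_williamsonGenerator hγ]
      refine williamson_strictAnti hn hγ (NNReal.coe_nonneg _)
        (by exact_mod_cast (ENNReal.toNNReal_lt_toNNReal ha' hb').2 hab) fun h => ha ?_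
      ext
      rw [coe_williamsonGenerator hγ, h, Set.Icc.coe_zero]

end Williamson

/-! ### Uniform laws on simplices and their survival functions -/

theorem volume_corner_simplex {n : ℕ} (z : Fin n → ℝ) {t : ℝ} (h : ∑ i, z i ≤ t) :
    volume {x : Fin n → ℝ | (∀ i, z i ≤ x i) ∧ ∑ i, x i ≤ t} =
      ENNReal.ofReal ((t - ∑ i, z i) ^ n / n.factorial) := by
  induction n generalizing t with
  | zero =>
    have : {x : Fin 0 → ℝ | (∀ i, z i ≤ x i) ∧ ∑ i, x i ≤ t} = Set.univ :=
      Set.eq_univ_of_forall fun x => ⟨fun i => i.elim0, by simpa using h⟩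
    rw [this, volume_pi, Measure.pi_univ]
    simp
  | succ n ih =>
    have hmeas : ∀ n (z : Fin n → ℝ) (t : ℝ),
        MeasurableSet {x : Fin n → ℝ | (∀ i, z i ≤ x i) ∧ ∑ i, x i ≤ t} := fun n z t =>
      MeasurableSet.inter (measurableSet_Ici (a := z))
        (show MeasurableSet {x : Fin n → ℝ | ∑ i, x i ≤ t} from
          measurableSet_le (by fun_prop) (by fun_prop))
    have e := (volume_preserving_piFinSuccAbove (fun _ : Fin (n + 1) => ℝ) 0).symm
    rw [← e.measure_preimage (hmeas _ _ _).nullMeasurableSet, Measure.volume_eq_prod,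
      Measure.prod_apply (e.measurable (hmeas _ _ _))]
    set c := t - ∑ i : Fin n, z i.succ with hc
    have hzc : z 0 ≤ c := by rw [Fin.sum_univ_succ] at h; linarith
    have hsec : ∀ a : ℝ, volume (Prod.mk a ⁻¹' ((MeasurableEquiv.piFinSuccAbove
        (fun _ : Fin (n + 1) => ℝ) 0).symm ⁻¹' {x | (∀ i, z i ≤ x i) ∧ ∑ i, x i ≤ t})) =
        (Set.Icc (z 0) c).indicator (fun a => ENNReal.ofReal ((c - a) ^ n / n.factorial)) a := by
      intro a
      have hset : Prod.mk a ⁻¹' ((MeasurableEquiv.piFinSuccAbove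
          (fun _ : Fin (n + 1) => ℝ) 0).symm ⁻¹' {x | (∀ i, z i ≤ x i) ∧ ∑ i, x i ≤ t}) =
          {x | z 0 ≤ a ∧ (∀ i : Fin n, z i.succ ≤ x i) ∧ ∑ i, x i ≤ t - a} := by
        ext x
        simp [Fin.forall_fin_succ, Fin.sum_univ_succ, Fin.insertNthEquiv, and_assoc,
          le_sub_iff_add_le']
      rw [hset]
      by_cases ha : a ∈ Set.Icc (z 0) c
      · rw [Set.indicator_of_mem ha]
        simp only [ha.1, true_and]
        rw [ih _ (by have := ha.2; rw [hc] at this; linarith)]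
        congr 3
        rw [hc]; ring
      · rw [Set.indicator_of_notMem ha]
        convert measure_empty (μ := volume)
        ext x
        simp only [Set.mem_ofPred_eq, Set.mem_empty_iff_false, iff_false]
        rintro ⟨h1, h2, h3⟩
        refine ha ⟨h1, ?_⟩
        have := Finset.sum_le_sum fun i (_ : i ∈ Finset.univ) => h2 i
        rw [hc]; linarith
    simp only [hsec]
    rw [lintegral_indicator measurableSet_Icc, ← ofReal_integral_eq_lintegral_ofReal,
      integral_Icc_eq_integral_Ioc, ← intervalIntegral.integral_of_le hzc]
    · rw [intervalIntegral.integral_div,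
        intervalIntegral.integral_comp_sub_left (fun x => x ^ n), integral_pow, sub_self,
        Fin.sum_univ_succ, Nat.factorial_succ]
      congr 1
      rw [hc]
      push_cast
      field_simp
      ring
    · have hc : Continuous fun a : ℝ => (c - a) ^ n / n.factorial := by fun_prop
      exact hc.continuousOn.integrableOn_Icc
    · filter_upwards [ae_restrict_mem measurableSet_Icc] with a ha
      have := sub_nonneg.2 ha.2
      positivity

/-- The law of `(X, R)` where `R ∼ γ` and, given `R = r`, `X` is uniform on the simplex
`{x ≥ 0, ∑ x_i ≤ r}`. -/
noncomputable def simplexMixture (n : ℕ) (γ : Measure ℝ) : Measure ((Fin n → ℝ) × ℝ) :=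
  (volume.prod γ).withDensity
    ({p | (∀ i, 0 ≤ p.1 i) ∧ ∑ i, p.1 i ≤ p.2}.indicator
      fun p => ENNReal.ofReal (n.factorial / p.2 ^ n))

/-- For fixed r the event is a corner simplex of side r - t - ∑ z_i inside one of side r. The ratio
of volumes is the n-th power of the ratio of sides, which is the Williamson kernel at t + ∑ z_i. -/
theorem simplexMixture_survival {n : ℕ} (hn : n ≠ 0) {γ : Measure ℝ} [IsProbabilityMeasure γ]
    (hγ : ∀ᵐ r ∂γ, 0 < r) {z : Fin n → ℝ} {t : ℝ} (hz : ∀ i, 0 ≤ z i) (ht : 0 ≤ t) :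
    simplexMixture n γ {p | (∀ i, z i ≤ p.1 i) ∧ t ≤ p.2 - ∑ i, p.1 i} =
      ENNReal.ofReal (williamson n γ (∑ i, z i + t)) := by
  have hmeas : ∀ (z : Fin n → ℝ) (t : ℝ), MeasurableSet
      {p : (Fin n → ℝ) × ℝ | (∀ i, z i ≤ p.1 i) ∧ t ≤ p.2 - ∑ i, p.1 i} := fun z t =>
    MeasurableSet.inter (measurable_fst (measurableSet_Ici (a := z)))
      (show MeasurableSet {p : (Fin n → ℝ) × ℝ | t ≤ p.2 - ∑ i, p.1 i} from
        measurableSet_le (by fun_prop) (by fun_prop))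
  have hmeas0 : MeasurableSet
      {p : (Fin n → ℝ) × ℝ | (∀ i, 0 ≤ p.1 i) ∧ ∑ i, p.1 i ≤ p.2} := by
    simpa using hmeas 0 0
  have hsum : 0 ≤ ∑ i, z i := Finset.sum_nonneg fun i _ => hz i
  rw [simplexMixture, withDensity_apply _ (hmeas z t), ← lintegral_indicator (hmeas z t),
    Set.indicator_indicator, lintegral_prod_symm]
  swap
  · exact (Measurable.indicator (by fun_prop) ((hmeas z t).inter hmeas0)).aemeasurable
  rw [williamson, ofReal_integral_eq_lintegral_ofReal
    (integrable_williamsonKernel hγ (add_nonneg hsum ht))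
    (ae_of_all _ fun _ => williamsonKernel_nonneg)]
  refine lintegral_congr_ae ?_
  filter_upwards [hγ] with r hr
  have hset : ∀ x : Fin n → ℝ, ({p : (Fin n → ℝ) × ℝ | (∀ i, z i ≤ p.1 i) ∧
      t ≤ p.2 - ∑ i, p.1 i} ∩ {p | (∀ i, 0 ≤ p.1 i) ∧ ∑ i, p.1 i ≤ p.2}).indicator
        (fun p => ENNReal.ofReal (n.factorial / p.2 ^ n)) (x, r) =
      {x : Fin n → ℝ | (∀ i, z i ≤ x i) ∧ ∑ i, x i ≤ r - t}.indicator
        (fun _ => ENNReal.ofReal (n.factorial / r ^ n)) x := by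
    intro x
    simp only [Set.indicator_apply]
    refine if_congr ?_ rfl rfl
    simp only [Set.mem_inter_iff, Set.mem_ofPred_eq]
    constructor
    · rintro ⟨⟨h1, h2⟩, h3, h4⟩
      exact ⟨h1, by linarith⟩
    · rintro ⟨h1, h2⟩
      exact ⟨⟨h1, by linarith⟩, fun i => (hz i).trans (h1 i), by linarith⟩
  simp only [hset]
  have hm : MeasurableSet {x : Fin n → ℝ | (∀ i, z i ≤ x i) ∧ ∑ i, x i ≤ r - t} :=
    MeasurableSet.inter (measurableSet_Ici (a := z))
      (show MeasurableSet {x : Fin n → ℝ | ∑ i, x i ≤ r - t} from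
        measurableSet_le (by fun_prop) (by fun_prop))
  rw [lintegral_indicator hm, setLIntegral_const]
  by_cases h : ∑ i, z i ≤ r - t
  · have h0 : 0 ≤ 1 - (∑ i, z i + t) / r := by
      rw [sub_nonneg, div_le_one hr]; linarith
    rw [volume_corner_simplex z h, ← ENNReal.ofReal_mul (by positivity), williamsonKernel,
      max_eq_right h0]
    congr 1
    have : 1 - (∑ i, z i + t) / r = (r - t - ∑ i, z i) / r := by field_simp; ring
    rw [this, div_pow]
    have : (n.factorial : ℝ) ≠ 0 := by exact_mod_cast n.factorial_ne_zero
    field_simp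
  · rw [williamsonKernel_eq_zero hn hr (by linarith)]
    have : {x : Fin n → ℝ | (∀ i, z i ≤ x i) ∧ ∑ i, x i ≤ r - t} = ∅ := by
      ext x
      simp only [Set.mem_ofPred_eq, Set.mem_empty_iff_false, iff_false]
      rintro ⟨h1, h2⟩
      exact h ((Finset.sum_le_sum fun i (_ : i ∈ Finset.univ) => h1 i).trans h2)
    simp [this]

/-! ### From survival functions to Archimedean copulas -/

namespace IsGenerator

variable {ψ : ℝ≥0 → I}

theorem le_iff (hψ : IsGenerator ψ) {z w : ℝ≥0} (hz : ψ z ≠ 0) : ψ w ≤ ψ z ↔ z ≤ w := by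
  refine ⟨fun h => ?_, fun h => hψ.antitone h⟩
  by_contra! hw
  have heq : ψ w = ψ z := le_antisymm h (hψ.antitone hw.le)
  have h1 := hψ.pseudoInverse_apply (heq.symm ▸ hz : ψ w ≠ 0)
  rw [heq, hψ.pseudoInverse_apply hz] at h1
  exact hw.ne (by exact_mod_cast h1.symm)

variable {d : ℕ} {Ω : Type*} [MeasurableSpace Ω] {ρ : Measure Ω}
  {Z : Ω → Fin d → ℝ≥0}

theorem survival_coord (h : ∀ z : Fin d → ℝ≥0, ρ.real {ω | ∀ i, z i ≤ Z ω i} = ψ (∑ i, z i))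
    (i : Fin d) (t : ℝ≥0) : ρ.real {ω | t ≤ Z ω i} = ψ t := by
  have := h (Pi.single i t)
  rw [Finset.sum_pi_single'] at this
  simp only [Finset.mem_univ, if_true] at this
  rw [← this]
  congr 1
  ext ω
  simp only [Set.mem_ofPred_eq]
  refine ⟨fun ht j => ?_, fun ht => by simpa using ht i⟩
  by_cases hj : j = i
  · subst hj; simpa using ht
  · simp [hj]

variable [IsProbabilityMeasure ρ]

/-- The event lies in {t ≤ Z_i} for every t with ψ(t) > 0. That set has mass ψ(t), which takes
arbitrarily small positive values. -/
theorem measure_generator_eq_zero (hψ : IsGenerator ψ)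
    (h : ∀ z : Fin d → ℝ≥0, ρ.real {ω | ∀ i, z i ≤ Z ω i} = ψ (∑ i, z i)) (i : Fin d) :
    ρ.real {ω | ψ (Z ω i) = 0} = 0 := by
  refine le_antisymm (le_of_forall_gt_imp_ge_of_dense fun y hy => ?_) measureReal_nonneg
  rcases le_total 1 y with h1 | h1
  · exact measureReal_le_one.trans h1
  obtain ⟨t, ht⟩ := hψ.exists_eq (y := ⟨y, hy.le, h1⟩) (fun h => hy.ne' (congrArg Subtype.val h))
  have hne : ψ t ≠ 0 := ht ▸ (fun h => hy.ne' (congrArg Subtype.val h))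
  refine (measureReal_mono fun ω hω => ?_).trans (((survival_coord h i t).trans
    (congrArg Subtype.val ht)).le)
  exact (hψ.le_iff hne).1 ((show ψ (Z ω i) = 0 from hω) ▸ bot_le)

/-- Applying the generator to a vector with survival function `ψ(∑ z_i)` yields an Archimedean
copula. -/
theorem exists_copula (hψ : IsGenerator ψ) (hZ : Measurable Z)
    (h : ∀ z : Fin d → ℝ≥0, ρ.real {ω | ∀ i, z i ≤ Z ω i} = ψ (∑ i, z i)) :
    ∃ C : Copula d, C.measure = ρ.map (fun ω i => ψ (Z ω i)) ∧
      ∀ x, C x = (generatorExt ψ (∑ i, pseudoInverse ψ (x i)) : ℝ) := by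
  have hψm : Measurable ψ := hψ.continuous.measurable
  have hUi : ∀ i, Measurable fun ω => ψ (Z ω i) := fun i =>
    hψm.comp ((measurable_pi_apply i).comp hZ)
  have hU : Measurable fun ω i => ψ (Z ω i) := measurable_pi_lambda _ hUi
  set μ := ρ.map (fun ω i => ψ (Z ω i)) with hμ
  have : IsProbabilityMeasure μ := Measure.isProbabilityMeasure_map hU.aemeasurable
  have hI : ∀ x, μ.real (Set.Iic x) = (generatorExt ψ (∑ i, pseudoInverse ψ (x i)) : ℝ) := by
    intro x
    rw [hμ, map_measureReal_apply hU measurableSet_Iic]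
    by_cases hx : ∃ i, x i = 0
    · obtain ⟨i, hi⟩ := hx
      have h1 : generatorExt ψ (∑ i, pseudoInverse ψ (x i)) = 0 := by
        refine le_antisymm ?_ bot_le
        rw [← hψ.generatorExt_pseudoInverse_zero, ← hi]
        exact hψ.generatorExt_antitone
          (Finset.single_le_sum (f := fun i => pseudoInverse ψ (x i)) (fun _ _ => zero_le)
            (Finset.mem_univ i))
      rw [h1]
      refine le_antisymm ?_ measureReal_nonneg
      refine (measureReal_mono fun ω hω => ?_).trans (hψ.measure_generator_eq_zero h i).le
      exact le_antisymm (hi ▸ hω i) bot_le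
    · push Not at hx
      choose z hz using fun i => hψ.exists_eq (hx i)
      obtain rfl : (fun i => ψ (z i)) = x := funext hz
      simp only [hψ.pseudoInverse_apply (hx _)]
      rw [← ENNReal.ofNNReal_finsetSum, generatorExt, if_neg ENNReal.coe_ne_top,
        ENNReal.toNNReal_coe, ← h]
      congr 1
      ext ω
      exact forall_congr' fun i => hψ.le_iff (hx i)
  have hmarg : ∀ i, μ.map (fun x => x i) = volume := by
    intro i
    rw [hμ, Measure.map_map (measurable_pi_apply i) hU]
    change ρ.map (fun ω => ψ (Z ω i)) = volume
    have : IsProbabilityMeasure (ρ.map fun ω => ψ (Z ω i)) :=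
      Measure.isProbabilityMeasure_map (hUi i).aemeasurable
    refine Measure.ext_of_Iic _ _ fun y => ?_
    rw [unitInterval.volume_Iic, Measure.map_apply (hUi i) measurableSet_Iic,
      ← ofReal_measureReal]
    congr 1
    by_cases hy : y = 0
    · subst hy
      rw [Set.Icc.coe_zero, ← hψ.measure_generator_eq_zero h i]
      congr 1
      ext ω
      exact le_bot_iff (a := ψ (Z ω i))
    · obtain ⟨t, rfl⟩ := hψ.exists_eq hy
      rw [← survival_coord h i t]
      congr 1
      ext ω
      exact hψ.le_iff hy
  refine ⟨⟨_, μ, this, hmarg, hI⟩, ?_, fun x => rfl⟩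
  exact (Copula.measure_unique _ μ hI).symm

end IsGenerator

/-! ### The random vector on the simplex -/

section SimplexMixture

variable {n : ℕ} {γ : Measure ℝ}

theorem ae_simplexMixture :
    ∀ᵐ p ∂simplexMixture n γ, (∀ i, 0 ≤ p.1 i) ∧ ∑ i, p.1 i ≤ p.2 := by
  have hmeas : MeasurableSet
      {p : (Fin n → ℝ) × ℝ | (∀ i, 0 ≤ p.1 i) ∧ ∑ i, p.1 i ≤ p.2} :=
    MeasurableSet.inter (measurable_fst (measurableSet_Ici (a := (0 : Fin n → ℝ))))
      (show MeasurableSet {p : (Fin n → ℝ) × ℝ | ∑ i, p.1 i ≤ p.2} from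
        measurableSet_le (by fun_prop) (by fun_prop))
  rw [ae_iff]
  change simplexMixture n γ {p | (∀ i, 0 ≤ p.1 i) ∧ ∑ i, p.1 i ≤ p.2}ᶜ = 0
  rw [simplexMixture, withDensity_apply _ hmeas.compl, ← lintegral_indicator hmeas.compl,
    Set.indicator_indicator]
  simp

variable [IsProbabilityMeasure γ]

theorem isProbabilityMeasure_simplexMixture (hn : n ≠ 0) (hγ : ∀ᵐ r ∂γ, 0 < r) :
    IsProbabilityMeasure (simplexMixture n γ) := by
  constructor
  have h := simplexMixture_survival hn hγ (z := 0) (t := 0) (fun _ => le_rfl) le_rfl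
  simp only [Pi.zero_apply, Finset.sum_const_zero, add_zero, williamson_zero,
    ENNReal.ofReal_one] at h
  rw [← h]
  refine measure_congr (Filter.eventuallyEq_set.2 ?_)
  filter_upwards [ae_simplexMixture] with p hp
  simpa using hp

/-- The vector `(x_1, …, x_n, r - ∑ x_i)`, with negative coordinates cut off at `0`. -/
noncomputable def simplexVector (p : (Fin n → ℝ) × ℝ) : Fin (n + 1) → ℝ≥0 :=
  Fin.snoc (α := fun _ => ℝ≥0) (fun i => (p.1 i).toNNReal) (p.2 - ∑ i, p.1 i).toNNReal

@[simp]
theorem simplexVector_castSucc (p : (Fin n → ℝ) × ℝ) (i : Fin n) :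
    simplexVector p i.castSucc = (p.1 i).toNNReal := by simp [simplexVector]

@[simp]
theorem simplexVector_last (p : (Fin n → ℝ) × ℝ) :
    simplexVector p (Fin.last n) = (p.2 - ∑ i, p.1 i).toNNReal := by simp [simplexVector]

@[fun_prop]
theorem measurable_simplexVector : Measurable (simplexVector (n := n)) := by
  refine measurable_pi_lambda _ fun i => ?_
  induction i using Fin.lastCases with
  | last => simp only [simplexVector_last]; fun_prop
  | cast i => simp only [simplexVector_castSucc]; fun_prop

theorem simplexVector_survival (hn : n ≠ 0) (hγ : ∀ᵐ r ∂γ, 0 < r) (z : Fin (n + 1) → ℝ≥0) :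
    (simplexMixture n γ).real {p | ∀ i, z i ≤ simplexVector p i} =
      williamsonGenerator n γ (∑ i, z i) := by
  have h := simplexMixture_survival hn hγ (z := fun i => (z i.castSucc : ℝ))
    (t := z (Fin.last n)) (fun _ => NNReal.coe_nonneg _) (NNReal.coe_nonneg _)
  rw [coe_williamsonGenerator hγ, Fin.sum_univ_castSucc, NNReal.coe_add, NNReal.coe_sum,
    ← ENNReal.toReal_ofReal (williamson_nonneg _), ← h, measureReal_def]
  congr 1
  refine measure_congr (Filter.eventuallyEq_set.2 ?_)
  filter_upwards [ae_simplexMixture] with p hp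
  simp only [Fin.forall_fin_succ', simplexVector_castSucc, simplexVector_last]
  refine and_congr (forall_congr' fun i => ?_) ?_
  · exact (Real.le_toNNReal_iff_coe_le (hp.1 i))
  · exact (Real.le_toNNReal_iff_coe_le (sub_nonneg.2 hp.2))

end SimplexMixture

theorem IsGenerator.pseudoInverse_antitone {ψ : ℝ≥0 → I} (hψ : IsGenerator ψ) :
    Antitone (pseudoInverse ψ) := by
  intro y y' h
  rcases h.eq_or_lt with rfl | h
  · exact le_rfl
  have hy' : y' ≠ 0 := fun h0 => absurd (h0 ▸ h) not_lt_bot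
  obtain ⟨z, rfl⟩ := hψ.exists_eq hy'
  rw [hψ.pseudoInverse_apply hy']
  refine le_sInf fun w (hw : generatorExt ψ w = y) => ?_
  by_contra! hwz
  have h1 := hψ.generatorExt_antitone hwz.le
  rw [hw, generatorExt, if_neg ENNReal.coe_ne_top, ENNReal.toNNReal_coe] at h1
  exact absurd h (not_lt.2 h1)

/-! ### Recognising the type of the kernel from carriers of the measure -/

namespace Copula

variable {n : ℕ} (C : Copula (n + 1))

theorem marginal_compProd_kernel : C.marginal ⊗ₘ C.kernel = C.splitMeasure :=
  C.splitMeasure.disintegrate C.splitMeasure.condKernel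

theorem ae_coord_ne {d : ℕ} (C : Copula d) (i : Fin d) (y : I) : ∀ᵐ u ∂C.measure, u i ≠ y := by
  have h : ∀ᵐ v ∂(volume : Measure I), v ≠ y := by simp [ae_iff]
  rw [← C.map_measure i] at h
  exact ae_of_ae_map (measurable_pi_apply i).aemeasurable h

/-- Almost every kernel lives on a countable section, and the points of a countable set that are not
atoms have total mass zero. -/
theorem discreteComponent_eq_one (h : ∃ E : Set ((Fin n → I) × I),
    (∀ᵐ p ∂C.splitMeasure, p ∈ E) ∧ ∀ x, (Prod.mk x ⁻¹' E).Countable) : C.discreteComponent Set.univ = 1 := by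
  obtain ⟨E, hE, hc⟩ := h
  rw [← marginal_compProd_kernel] at hE
  rw [discreteComponent, Measure.compProd_apply .univ]
  have : ∀ᵐ x ∂C.marginal, discreteKernel C.kernel x (Prod.mk x ⁻¹' Set.univ) = 1 := by
    filter_upwards [Measure.ae_ae_of_ae_compProd hE] with x hx
    have hnull : C.kernel x {y | C.kernel x {y} ≠ 0}ᶜ = 0 := by
      have h2 : C.kernel x (⋃ y ∈ {y ∈ Prod.mk x ⁻¹' E | C.kernel x {y} = 0}, {y}) = 0 :=
        (measure_biUnion_null_iff ((hc x).mono fun y hy => hy.1)).2 fun y hy => hy.2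
      refine measure_mono_null (fun y hy => ?_) (measure_union_null h2 hx)
      by_cases hyE : y ∈ Prod.mk x ⁻¹' E
      · exact Or.inl (Set.mem_biUnion ⟨hyE, by simpa using hy⟩ rfl)
      · exact Or.inr hyE
    change discretePart (C.kernel x) Set.univ = 1
    rw [discretePart, Measure.restrict_apply_univ]
    exact (prob_compl_eq_zero_iff₀ ((measurableSet_atoms C.kernel).compl.preimage
      measurable_prodMk_left).nullMeasurableSet).1 hnull
  rw [lintegral_congr_ae this]
  simp

/-- Null sections make the kernels Lebesgue-singular. The set of pairs (x, y) with y an atom of the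
kernel at x is measurable with countable sections, so `hA` excludes atoms for almost every x. -/
theorem singularComponent_eq_one (h : ∃ E : Set ((Fin n → I) × I), MeasurableSet E ∧
    (∀ᵐ p ∂C.splitMeasure, p ∈ E) ∧ ∀ x, volume (Prod.mk x ⁻¹' E) = 0)
    (hA : ∀ A : Set ((Fin n → I) × I), MeasurableSet A → (∀ x, (Prod.mk x ⁻¹' A).Countable) →
      C.splitMeasure A = 0) : C.singularComponent Set.univ = 1 := by
  obtain ⟨E, hEm, hE, hc⟩ := h
  have hatoms := hA _ (measurableSet_atoms C.kernel).compl fun x => by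
    have := Measure.countable_meas_pos_of_disjoint_iUnion (μ := C.kernel x)
      (As := fun y : I => {y}) (fun y => measurableSet_singleton y)
      (fun a b hab => by simpa using hab)
    simpa [pos_iff_ne_zero, Set.preimage] using this
  have hatoms' : ∀ᵐ p ∂C.splitMeasure, C.kernel p.1 {p.2} = 0 := by
    rw [ae_iff]; exact hatoms
  rw [← marginal_compProd_kernel] at hE hatoms'
  rw [singularComponent, Measure.compProd_apply .univ]
  have : ∀ᵐ x ∂C.marginal, singContKernel C.kernel x (Prod.mk x ⁻¹' Set.univ) = 1 := by
    filter_upwards [Measure.ae_ae_of_ae_compProd hE, Measure.ae_ae_of_ae_compProd hatoms']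
      with x hx hx'
    change singContPart (C.kernel x) Set.univ = 1
    have hsing : (C.kernel x).singularPart volume = C.kernel x :=
      Measure.singularPart_eq_self.2 ⟨(Prod.mk x ⁻¹' E)ᶜ,
        (hEm.preimage measurable_prodMk_left).compl, hx, by rw [compl_compl]; exact hc x⟩
    rw [singContPart, hsing, Measure.restrict_apply_univ]
    have hm : MeasurableSet {y | C.kernel x {y} = 0} :=
      (measurableSet_atoms C.kernel).preimage measurable_prodMk_left
    exact (prob_compl_eq_zero_iff hm).1 hx'
  rw [lintegral_congr_ae this]
  simp

end Copula

/-! ### Discrete and singular radial laws give discrete and singular copulas -/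

theorem volume_image_eq_zero_of_lipschitzOnWith {f : ℝ → ℝ} {A : Set ℝ} {K : ℝ≥0}
    (hf : LipschitzOnWith K f A) (hA : volume A = 0) : volume (f '' A) = 0 := by
  rw [← hausdorffMeasure_real] at hA ⊢
  have := hf.hausdorffMeasure_image_le zero_le_one
  rw [hA, mul_zero] at this
  exact le_antisymm this zero_le

section WilliamsonCopula

variable {n : ℕ} {γ : Measure ℝ} [IsProbabilityMeasure γ]

theorem lipschitzOnWith_williamson (hγ : ∀ᵐ r ∂γ, 0 < r) {a : ℝ} (ha : 0 < a) :
    LipschitzOnWith (n / a).toNNReal (williamson n γ) (Set.Ici a) := by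
  refine LipschitzOnWith.of_dist_le_mul fun s hs s' hs' => ?_
  rw [Real.coe_toNNReal _ (by positivity), Real.dist_eq, Real.dist_eq]
  have key : ∀ s s' : ℝ, a ≤ s → s ≤ s' →
      |williamson n γ s - williamson n γ s'| ≤ n / a * |s - s'| := by
    intro s s' hs h
    rw [abs_of_nonneg (sub_nonneg.2 (williamson_anti hγ (ha.le.trans hs) h)), abs_sub_comm,
      abs_of_nonneg (sub_nonneg.2 h)]
    refine (williamson_sub_le hγ (ha.le.trans hs) h (by linarith)).trans ?_
    rw [div_mul_eq_mul_div, mul_div_assoc]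
    have := sub_nonneg.2 h
    gcongr
    linarith
  rcases le_total s s' with h | h
  · exact key s s' hs h
  · rw [abs_sub_comm, abs_sub_comm s]
    exact key s' s hs' h

/-- The Lipschitz constant n/a on [a,∞) degenerates at 0, so (0,∞) is exhausted by the half-lines
[1/(k+1),∞). -/
theorem volume_image_williamson (hγ : ∀ᵐ r ∂γ, 0 < r) {A : Set ℝ} (hA : volume A = 0) :
    volume (williamson n γ '' (A ∩ Set.Ioi 0)) = 0 := by
  have hsub : williamson n γ '' (A ∩ Set.Ioi 0) ⊆
      ⋃ k : ℕ, williamson n γ '' (A ∩ Set.Ici (1 / ((k : ℝ) + 1))) := by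
    rintro _ ⟨s, ⟨hs, hs0⟩, rfl⟩
    obtain ⟨k, hk⟩ := exists_nat_one_div_lt (show (0 : ℝ) < s from hs0)
    exact Set.mem_iUnion.2 ⟨k, s, ⟨hs, hk.le⟩, rfl⟩
  refine measure_mono_null hsub (measure_iUnion_null fun k => ?_)
  exact volume_image_eq_zero_of_lipschitzOnWith ((lipschitzOnWith_williamson hγ
    (by positivity)).mono Set.inter_subset_right) (measure_mono_null Set.inter_subset_left hA)

variable {C : Copula (n + 1)}

theorem splitMeasure_williamson (hn : n ≠ 0) (hγ : ∀ᵐ r ∂γ, 0 < r)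
    (hC : C.measure = (simplexMixture n γ).map
      fun p i => williamsonGenerator n γ (simplexVector p i)) :
    C.splitMeasure = (simplexMixture n γ).map fun p =>
      (fun i => williamsonGenerator n γ (p.1 i).toNNReal,
        williamsonGenerator n γ (p.2 - ∑ i, p.1 i).toNNReal) := by
  have hψ : Measurable (williamsonGenerator n γ) :=
    (isGenerator_williamson hn hγ).continuous.measurable
  have hU : Measurable fun (p : (Fin n → ℝ) × ℝ) i =>
      williamsonGenerator n γ (simplexVector p i) := by fun_prop
  rw [Copula.splitMeasure, hC, Measure.map_map (by fun_prop) hU]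
  congr 1
  ext p : 1
  simp

theorem ae_williamsonGenerator_ne (hn : n ≠ 0) (hγ : ∀ᵐ r ∂γ, 0 < r)
    (hC : C.measure = (simplexMixture n γ).map
      fun p i => williamsonGenerator n γ (simplexVector p i)) :
    ∀ᵐ p ∂simplexMixture n γ, ∀ i, williamsonGenerator n γ (simplexVector p i) ≠ 0 := by
  have hψ : Measurable (williamsonGenerator n γ) :=
    (isGenerator_williamson hn hγ).continuous.measurable
  have hU : Measurable fun (p : (Fin n → ℝ) × ℝ) i =>
      williamsonGenerator n γ (simplexVector p i) := by fun_prop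
  refine ae_all_iff.2 fun i => ?_
  have := C.ae_coord_ne i 0
  rw [hC] at this
  exact ae_of_ae_map hU.aemeasurable this

/-- The set of points of the unit cube whose `ψ`-radius `∑ φ(u_i)` lies in `S`. -/
def radialSet (n : ℕ) (ψ : ℝ≥0 → I) (S : Set ℝ) : Set ((Fin n → I) × I) :=
  {q | ∑ i, pseudoInverse ψ (q.1 i) + pseudoInverse ψ q.2 ≠ ∞ ∧
    (∑ i, pseudoInverse ψ (q.1 i) + pseudoInverse ψ q.2).toReal ∈ S}

theorem measurableSet_radialSet {ψ : ℝ≥0 → I} (hψ : IsGenerator ψ) {S : Set ℝ}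
    (hS : MeasurableSet S) : MeasurableSet (radialSet n ψ S) := by
  have hφ : Measurable (pseudoInverse ψ) := hψ.pseudoInverse_antitone.measurable
  have hf : Measurable fun q : (Fin n → I) × I =>
      ∑ i, pseudoInverse ψ (q.1 i) + pseudoInverse ψ q.2 := by fun_prop
  exact (hf (measurableSet_singleton ∞).compl).inter (hf.ennreal_toReal hS)

/-- For fixed u the radius is c + φ(v), so the section is the ψ-image of a translate of S. The value
v = 0 is set apart because φ(0) need not be finite. -/
theorem preimage_radialSet_subset {ψ : ℝ≥0 → I} (hψ : IsGenerator ψ) {S : Set ℝ}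
    (u : Fin n → I) : ∃ c : ℝ, Prod.mk u ⁻¹' radialSet n ψ S ⊆
      insert 0 ((fun t : ℝ => ψ t.toNNReal) '' ((fun t => c + t) ⁻¹' S ∩ Set.Ici 0)) := by
  refine ⟨(∑ i, pseudoInverse ψ (u i)).toReal, ?_⟩
  rintro v ⟨h1, h2⟩
  by_cases hv : v = 0
  · exact Or.inl hv
  obtain ⟨z, rfl⟩ := hψ.exists_eq hv
  rw [hψ.pseudoInverse_apply hv] at h1 h2
  rw [ENNReal.toReal_add (ne_top_of_le_ne_top h1 le_self_add) ENNReal.coe_ne_top] at h2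
  exact Or.inr ⟨z, ⟨h2, z.coe_nonneg⟩, by simp⟩

/-- Almost surely no coordinate is 0, so φ inverts ψ and the radius is the sum of the simplex
coordinates, namely R. -/
theorem ae_mem_radialSet (hn : n ≠ 0) (hγ : ∀ᵐ r ∂γ, 0 < r)
    (hC : C.measure = (simplexMixture n γ).map
      fun p i => williamsonGenerator n γ (simplexVector p i)) {S : Set ℝ}
    (hSm : MeasurableSet S) (hS : ∀ᵐ r ∂γ, r ∈ S) :
    ∀ᵐ q ∂C.splitMeasure, q ∈ radialSet n (williamsonGenerator n γ) S := by
  have hψ := isGenerator_williamson hn hγ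
  have hψm : Measurable (williamsonGenerator n γ) := hψ.continuous.measurable
  rw [splitMeasure_williamson hn hγ hC,
    ae_map_iff (p := (· ∈ radialSet n (williamsonGenerator n γ) S)) (by fun_prop)
      (measurableSet_radialSet hψ hSm)]
  have hS' : ∀ᵐ p ∂simplexMixture n γ, p.2 ∈ S :=
    (withDensity_absolutelyContinuous _ _).ae_le (Measure.quasiMeasurePreserving_snd.ae hS)
  filter_upwards [hS', ae_simplexMixture, ae_williamsonGenerator_ne hn hγ hC] with p hp1 hp2 hp3
  have h1 : ∀ i, pseudoInverse (williamsonGenerator n γ)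
      (williamsonGenerator n γ (p.1 i).toNNReal) = (p.1 i).toNNReal := fun i =>
    hψ.pseudoInverse_apply (by simpa using hp3 i.castSucc)
  have h2 : pseudoInverse (williamsonGenerator n γ)
      (williamsonGenerator n γ (p.2 - ∑ i, p.1 i).toNNReal) = (p.2 - ∑ i, p.1 i).toNNReal :=
    hψ.pseudoInverse_apply (by simpa using hp3 (Fin.last n))
  have h3 : ∑ i, ((p.1 i).toNNReal : ℝ≥0∞) + ((p.2 - ∑ i, p.1 i).toNNReal : ℝ≥0∞) =
      (p.2.toNNReal : ℝ≥0∞) := by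
    rw [← ENNReal.ofNNReal_finsetSum, ← ENNReal.coe_add,
      ← Real.toNNReal_sum_of_nonneg fun i _ => hp2.1 i,
      ← Real.toNNReal_add (Finset.sum_nonneg fun i _ => hp2.1 i) (sub_nonneg.2 hp2.2)]
    congr 2
    ring
  have h4 : 0 ≤ p.2 := (Finset.sum_nonneg fun i _ => hp2.1 i).trans hp2.2
  simp only [radialSet, Set.mem_ofPred_eq, h1, h2, h3]
  exact ⟨ENNReal.coe_ne_top, by simpa [h4] using hp1⟩

theorem discreteComponent_williamson (hn : n ≠ 0) (hγ : ∀ᵐ r ∂γ, 0 < r)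
    (hC : C.measure = (simplexMixture n γ).map
      fun p i => williamsonGenerator n γ (simplexVector p i)) {S : Set ℝ}
    (hSc : S.Countable) (hS : ∀ᵐ r ∂γ, r ∈ S) : C.discreteComponent Set.univ = 1 := by
  refine C.discreteComponent_eq_one
    ⟨_, ae_mem_radialSet hn hγ hC hSc.measurableSet hS, fun u => ?_⟩
  obtain ⟨c, hc⟩ := preimage_radialSet_subset (isGenerator_williamson hn hγ) (S := S) u
  refine Set.Countable.mono hc (Set.Countable.insert _ (Set.Countable.image ?_ _))
  exact (hSc.preimage (add_right_injective c)).mono Set.inter_subset_left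

theorem splitMeasure_eq_zero_of_countable_sections [NullSingletonClass γ] (hn : n ≠ 0)
    (hγ : ∀ᵐ r ∂γ, 0 < r) (hC : C.measure = (simplexMixture n γ).map
      fun p i => williamsonGenerator n γ (simplexVector p i))
    {A : Set ((Fin n → I) × I)} (hAm : MeasurableSet A)
    (hA : ∀ x, (Prod.mk x ⁻¹' A).Countable) : C.splitMeasure A = 0 := by
  have hψ := isGenerator_williamson hn hγ
  have hψm : Measurable (williamsonGenerator n γ) := hψ.continuous.measurable
  rw [splitMeasure_williamson hn hγ hC, Measure.map_apply (by fun_prop) hAm]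
  set T : (Fin n → ℝ) × ℝ → (Fin n → I) × I := fun p =>
      (fun i => williamsonGenerator n γ (p.1 i).toNNReal,
        williamsonGenerator n γ (p.2 - ∑ i, p.1 i).toNNReal) with hT
  have hTm : Measurable T := by fun_prop
  -- On B, for fixed x, the map r ↦ ψ(r - ∑ x_i) is injective. Each section of B thus embeds in a
  -- countable section of A and is null for the atomless γ. Outside B only a null part of the event
  -- remains.
  set B : Set ((Fin n → ℝ) × ℝ) := T ⁻¹' A ∩ ({p | (T p).2 ≠ 0} ∩ {p | ∑ i, p.1 i ≤ p.2}) with hB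
  have hBm : MeasurableSet B := by
    refine (hTm hAm).inter (MeasurableSet.inter ?_ ?_)
    · exact (measurable_snd.comp hTm) (measurableSet_singleton 0).compl
    · exact measurableSet_le (by fun_prop) (by fun_prop)
  have hB0 : simplexMixture n γ B = 0 := by
    refine withDensity_absolutelyContinuous _ _ ((Measure.measure_prod_null hBm).2 ?_)
    refine ae_of_all _ fun x => Set.Countable.measure_zero ?_ γ
    refine Set.countable_of_injective_of_countable_image
      (f := fun r => williamsonGenerator n γ (r - ∑ i, x i).toNNReal) ?_
      ((hA fun i => williamsonGenerator n γ (x i).toNNReal).mono ?_)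
    · rintro r ⟨-, h1, h2⟩ r' ⟨-, h1', h2'⟩ h
      have e := congrArg (pseudoInverse (williamsonGenerator n γ)) h
      simp only at e
      rw [hψ.pseudoInverse_apply h1, hψ.pseudoInverse_apply h1', ENNReal.coe_inj,
        Real.toNNReal_eq_toNNReal_iff (sub_nonneg.2 h2) (sub_nonneg.2 h2')] at e
      linarith
    · rintro _ ⟨r, hr, rfl⟩
      exact hr.1
  refine le_antisymm (le_of_le_of_eq (measure_mono_ae ?_) hB0) zero_le
  filter_upwards [ae_simplexMixture, ae_williamsonGenerator_ne hn hγ hC] with p hp1 hp2 hp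
  exact ⟨hp, by simpa [hT] using hp2 (Fin.last n), hp1.2⟩

theorem singularComponent_williamson [NullSingletonClass γ] (hn : n ≠ 0) (hγ : ∀ᵐ r ∂γ, 0 < r)
    (hC : C.measure = (simplexMixture n γ).map
      fun p i => williamsonGenerator n γ (simplexVector p i)) {S : Set ℝ}
    (hSm : MeasurableSet S) (hS0 : volume S = 0) (hS : ∀ᵐ r ∂γ, r ∈ S) :
    C.singularComponent Set.univ = 1 := by
  have hψ := isGenerator_williamson hn hγ
  refine C.singularComponent_eq_one ⟨_, measurableSet_radialSet hψ hSm,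
    ae_mem_radialSet hn hγ hC hSm hS, fun u => ?_⟩
    fun A hAm hA => splitMeasure_eq_zero_of_countable_sections hn hγ hC hAm hA
  obtain ⟨c, hc⟩ := preimage_radialSet_subset hψ (S := S) u
  refine measure_mono_null hc ?_
  rw [Set.insert_eq]
  refine measure_union_null (by simp) ?_
  have hA : volume ((fun t => c + t) ⁻¹' S) = 0 := by rwa [measure_preimage_add]
  have hsub : (fun t : ℝ => williamsonGenerator n γ t.toNNReal) ''
      ((fun t => c + t) ⁻¹' S ∩ Set.Ici 0) ⊆
      {williamsonGenerator n γ 0} ∪ (fun t : ℝ => williamsonGenerator n γ t.toNNReal) ''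
      ((fun t => c + t) ⁻¹' S ∩ Set.Ioi 0) := by
    rintro _ ⟨t, ⟨h1, h2⟩, rfl⟩
    rcases (show (0 : ℝ) ≤ t from h2).eq_or_lt with rfl | h
    · exact Or.inl (by simp)
    · exact Or.inr ⟨t, ⟨h1, h⟩, rfl⟩
  refine measure_mono_null hsub (measure_union_null (by simp) ?_)
  rw [unitInterval.volume_apply, Set.image_image]
  refine measure_mono_null ?_ (volume_image_williamson (n := n) hγ hA)
  rintro _ ⟨t, ht, rfl⟩
  refine ⟨t, ht, ?_⟩
  change _ = (williamsonGenerator n γ t.toNNReal : ℝ)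
  rw [coe_williamsonGenerator hγ, Real.coe_toNNReal _ (le_of_lt ht.2)]

end WilliamsonCopula

/-! ### Absolutely continuous radial laws give absolutely continuous copulas -/

theorem absolutelyContinuous_pi {d : ℕ} {μ ν : Fin d → Measure ℝ} [∀ i, SigmaFinite (μ i)]
    [∀ i, SigmaFinite (ν i)] (h : ∀ i, μ i ≪ ν i) : Measure.pi μ ≪ Measure.pi ν := by
  induction d with
  | zero =>
    have : μ = ν := funext fun i => i.elim0
    rw [this]
  | succ d ih =>
    rw [← (measurePreserving_piFinSuccAbove μ 0).symm.map_eq,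
      ← (measurePreserving_piFinSuccAbove ν 0).symm.map_eq]
    exact ((h 0).prod (ih fun j => h _)).map (MeasurableEquiv.measurable _)

/-- On the set P_i where the i-th marginal density is nonzero, Lebesgue measure is dominated by that
marginal. Since ρ is carried by the product of the P_i, it is dominated by Lebesgue measure on this
product, hence by the product of the marginals. -/
theorem absolutelyContinuous_pi_marginals {d : ℕ} {ρ : Measure (Fin d → ℝ)} [IsFiniteMeasure ρ]
    (hρ : ρ ≪ volume) : ρ ≪ Measure.pi fun i => ρ.map fun x => x i := by
  set ν : Fin d → Measure ℝ := fun i => ρ.map fun x => x i with hν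
  have hνv : ∀ i, ν i ≪ volume := fun i =>
    (hρ.map (measurable_pi_apply i)).trans
      (Measure.quasiMeasurePreserving_eval (fun _ : Fin d => (volume : Measure ℝ)) i).2
  set P : Fin d → Set ℝ := fun i => {x | (ν i).rnDeriv volume x ≠ 0} with hP
  have hPm : ∀ i, MeasurableSet (P i) := fun i =>
    Measure.measurable_rnDeriv _ _ (measurableSet_singleton 0).compl
  have hνP : ∀ i N, ν i N = 0 ↔ volume (P i ∩ N) = 0 := fun i N => by
    conv_lhs => rw [← Measure.withDensity_rnDeriv_eq _ _ (hνv i)]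
    exact withDensity_apply_eq_zero (Measure.measurable_rnDeriv _ _)
  have hac : ∀ i, volume.restrict (P i) ≪ ν i := fun i => Measure.AbsolutelyContinuous.mk
    fun N hN h0 => by
      rw [Measure.restrict_apply hN, Set.inter_comm]
      exact (hνP i N).1 h0
  have hcompl : ∀ i, ρ ((fun x : Fin d → ℝ => x i) ⁻¹' (P i)ᶜ) = 0 := fun i => by
    rw [← Measure.map_apply (measurable_pi_apply i) (hPm i).compl]
    exact (hνP i _).2 (by simp)
  refine Measure.AbsolutelyContinuous.trans ?_ (absolutelyContinuous_pi hac)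
  rw [← Measure.restrict_pi_pi, ← volume_pi]
  refine Measure.AbsolutelyContinuous.mk fun N hN h0 => ?_
  rw [Measure.restrict_apply hN] at h0
  refine measure_mono_null (fun x hx => ?_)
    (measure_union_null (hρ h0) (measure_iUnion_null hcompl))
  by_cases hxP : ∀ i, x i ∈ P i
  · exact Or.inl ⟨hx, fun i _ => hxP i⟩
  · obtain ⟨i, hi⟩ := not_forall.1 hxP
    exact Or.inr (Set.mem_iUnion.2 ⟨i, hi⟩)

/-- The shear (x, r) ↦ (x, r - ∑ x_i) preserves Lebesgue measure. -/
theorem map_simplexMixture_absolutelyContinuous {n : ℕ} {γ : Measure ℝ} [SFinite γ]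
    (hγ : γ ≪ volume) :
    (simplexMixture n γ).map (fun p => Fin.snoc (α := fun _ => ℝ) p.1 (p.2 - ∑ i, p.1 i)) ≪
      volume := by
  have h1 : simplexMixture n γ ≪ (volume : Measure (Fin n → ℝ)).prod volume :=
    (withDensity_absolutelyContinuous _ _).trans (Measure.AbsolutelyContinuous.rfl.prod hγ)
  have h2 : MeasurePreserving (fun p : (Fin n → ℝ) × ℝ => (p.1, p.2 - ∑ i, p.1 i))
      (volume.prod volume) (volume.prod volume) :=
    (MeasurePreserving.id _).skew_product (g := fun (x : Fin n → ℝ) (r : ℝ) => r - ∑ i, x i)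
      (by fun_prop)
      (ae_of_all _ fun x => (measurePreserving_sub_right volume (∑ i, x i)).map_eq)
  have h3 := ((volume_preserving_piFinSuccAbove (fun _ : Fin (n + 1) => ℝ) (Fin.last n)).symm).comp
    (Measure.measurePreserving_swap.comp h2)
  have h4 := h1.map h3.measurable
  rw [h3.map_eq] at h4
  refine (Eq.absolutelyContinuous ?_).trans h4
  congr 1
  ext p : 1
  simp [Fin.insertNthEquiv, Fin.insertNth_last']

section WilliamsonCopula

variable {n : ℕ} {γ : Measure ℝ} [IsProbabilityMeasure γ] {C : Copula (n + 1)}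

/-- The law of the simplex vector is dominated by the product of its marginals. Applying ψ
coordinatewise preserves this domination and makes each marginal uniform, so no regularity of φ
enters. -/
theorem isAbsolutelyContinuous_williamson (hn : n ≠ 0) (hγ : ∀ᵐ r ∂γ, 0 < r)
    (hC : C.measure = (simplexMixture n γ).map
      fun p i => williamsonGenerator n γ (simplexVector p i)) (hγv : γ ≪ volume) :
    C.IsAbsolutelyContinuous := by
  have hψ : Measurable (williamsonGenerator n γ) :=
    (isGenerator_williamson hn hγ).continuous.measurable
  have := isProbabilityMeasure_simplexMixture hn hγ
  set Z : (Fin n → ℝ) × ℝ → Fin (n + 1) → ℝ :=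
    fun p => Fin.snoc (α := fun _ => ℝ) p.1 (p.2 - ∑ i, p.1 i) with hZ
  have hZm : Measurable Z := by
    refine measurable_pi_lambda _ fun i => ?_
    induction i using Fin.lastCases with
    | last => simp only [hZ, Fin.snoc_last]; fun_prop
    | cast i => simp only [hZ, Fin.snoc_castSucc]; fun_prop
  have hZv : ∀ p i, (Z p i).toNNReal = simplexVector p i := fun p i => by
    induction i using Fin.lastCases with
    | last => simp [hZ]
    | cast i => simp [hZ]
  set F : ℝ → I := fun t => williamsonGenerator n γ t.toNNReal with hF
  have hFm : Measurable F := by fun_prop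
  set ρ := (simplexMixture n γ).map Z with hρ
  have : IsProbabilityMeasure ρ := Measure.isProbabilityMeasure_map hZm.aemeasurable
  have hFpi : Measurable fun (x : Fin (n + 1) → ℝ) i => F (x i) := by fun_prop
  have hCρ : C.measure = ρ.map fun x i => F (x i) := by
    rw [hC, hρ, Measure.map_map hFpi hZm]
    congr 1
    ext p i : 2
    simp [hF, hZv]
  have hmarg : ∀ i, (ρ.map fun x => x i).map F = volume := fun i => by
    rw [← C.map_measure i, hCρ, Measure.map_map hFm (measurable_pi_apply i),
      Measure.map_map (measurable_pi_apply i) hFpi]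
    rfl
  have hac := (absolutelyContinuous_pi_marginals
    (map_simplexMixture_absolutelyContinuous (n := n) hγv)).map hFpi
  have hprob : ∀ i, IsProbabilityMeasure ((ρ.map fun x => x i).map F) := fun i => by
    rw [hmarg]; infer_instance
  rw [← hZ, ← hρ, ← hCρ, Measure.pi_map_pi (f := fun _ => F) fun i => hFm.aemeasurable] at hac
  simp only [hmarg] at hac
  exact hac

end WilliamsonCopula

/-! ### The Cantor set and multiplicative perturbation of the radius -/

/-- Two copies at scale 1/3 give m ≤ (2/3)m, and m is finite by compactness. -/
theorem volume_cantorSet : volume cantorSet = 0 := by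
  have hfin : volume cantorSet ≠ ∞ := isCompact_cantorSet.measure_ne_top
  have h3 : ∀ a : ℝ, volume ((fun x => (a + x) / 3) '' cantorSet) =
      ENNReal.ofReal (1 / 3) * volume cantorSet := by
    intro a
    have : (fun x : ℝ => (a + x) / 3) '' cantorSet =
        (fun x => 3 * x) ⁻¹' ((fun x => -a + x) ⁻¹' cantorSet) := by
      ext x
      constructor
      · rintro ⟨y, hy, rfl⟩
        simpa [mul_div_cancel₀] using hy
      · exact fun hx => ⟨_, hx, by ring⟩
    rw [this, Real.volume_preimage_mul_left three_ne_zero, measure_preimage_add,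
      abs_of_pos (by norm_num), one_div]
  have h0 := h3 0
  simp only [zero_add] at h0
  have hle : volume cantorSet ≤ ENNReal.ofReal (2 / 3) * volume cantorSet := by
    conv_lhs => rw [cantorSet_eq_union_halves]
    refine (measure_union_le _ _).trans ?_
    rw [h0, h3, ← add_mul, ← ENNReal.ofReal_add (by norm_num) (by norm_num)]
    norm_num
  by_contra hne
  have hlt : ENNReal.ofReal (2 / 3) * volume cantorSet < 1 * volume cantorSet :=
    ENNReal.mul_lt_mul_left hne hfin (by
      rw [← ENNReal.ofReal_one]
      exact (ENNReal.ofReal_lt_ofReal_iff one_pos).2 (by norm_num))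
  rw [one_mul] at hlt
  exact absurd hle (not_le.2 hlt)

/-- There is a probability measure without atoms on the Cantor set. -/
theorem exists_measure_cantorSet :
    ∃ ν : Measure ℝ, IsProbabilityMeasure ν ∧ NullSingletonClass ν ∧ ∀ᵐ x ∂ν, x ∈ cantorSet := by
  have : StandardBorelSpace cantorSet := isClosed_cantorSet.measurableSet.standardBorel
  have hK : ¬ Countable cantorSet := fun h => by
    have := cantorSetEquivNatToBool.symm.injective.countable
    have h2 := Cardinal.mk_le_aleph0 (α := ℕ → Bool)
    simp only [Cardinal.mk_arrow, Cardinal.mk_bool, Cardinal.mk_nat, Cardinal.lift_id] at h2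
    exact absurd h2 (not_le.2 (Cardinal.cantor _))
  have hI : ¬ Countable I := fun h => by
    have := (Set.countable_coe_iff.1 h).measure_zero (volume : Measure ℝ)
    simp [unitInterval] at this
  -- A Borel isomorphism transports Lebesgue measure to the Cantor set without creating atoms.
  let e : I ≃ᵐ cantorSet := PolishSpace.measurableEquivOfNotCountable hI hK
  have hm : Measurable fun x : I => (e x : ℝ) := measurable_subtype_coe.comp e.measurable
  refine ⟨volume.map fun x : I => (e x : ℝ), Measure.isProbabilityMeasure_map hm.aemeasurable,
    ⟨fun x => ?_⟩, ?_⟩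
  · rw [Measure.map_apply hm (measurableSet_singleton x)]
    refine Set.Subsingleton.measure_zero (fun a ha b hb => ?_) _
    exact e.injective (Subtype.ext (Eq.trans ha (Eq.symm hb)))
  · rw [ae_map_iff (p := (· ∈ cantorSet)) hm.aemeasurable isClosed_cantorSet.measurableSet]
    exact ae_of_all _ fun x => (e x).2

/-- The law of `R (1 + δ V)` for independent `R ∼ γ` and `V ∼ ν`. -/
noncomputable def perturb (δ : ℝ) (γ ν : Measure ℝ) : Measure ℝ :=
  (γ.prod ν).map fun p => p.1 * (1 + δ * p.2)

section Perturb

variable {δ : ℝ} {γ ν : Measure ℝ} [IsProbabilityMeasure ν]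

theorem perturb_eq_zero [SFinite γ] {N : Set ℝ} (hN : MeasurableSet N)
    (h : ∀ᵐ r ∂γ, ν {v | r * (1 + δ * v) ∈ N} = 0) : perturb δ γ ν N = 0 := by
  have hm : Measurable fun p : ℝ × ℝ => p.1 * (1 + δ * p.2) := by fun_prop
  rw [perturb, Measure.map_apply hm hN, Measure.measure_prod_null (hm hN)]
  exact h

variable [IsProbabilityMeasure γ]

instance : IsProbabilityMeasure (perturb δ γ ν) :=
  Measure.isProbabilityMeasure_map (by fun_prop)

theorem ae_perturb_pos (hδ : 0 ≤ δ) (hγ : ∀ᵐ r ∂γ, 0 < r) (hν : ∀ᵐ v ∂ν, v ∈ I) :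
    ∀ᵐ r ∂perturb δ γ ν, 0 < r := by
  have hm : MeasurableSet {r : ℝ | ¬ 0 < r} := measurableSet_Ioi.compl
  refine perturb_eq_zero hm ?_
  filter_upwards [hγ] with r hr
  refine measure_mono_null (t := {v | v ∈ I}ᶜ) (fun v hv hvI => hv ?_) hν
  have : 0 ≤ v := hvI.1
  change 0 < r * (1 + δ * v)
  positivity

theorem perturb_absolutelyContinuous (hδ : 0 < δ) (hγ : ∀ᵐ r ∂γ, 0 < r) (hν : ν ≪ volume) :
    perturb δ γ ν ≪ volume := by
  refine Measure.AbsolutelyContinuous.mk fun N hN h0 => perturb_eq_zero hN ?_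
  filter_upwards [hγ] with r hr
  refine hν ?_
  have : {v : ℝ | r * (1 + δ * v) ∈ N} = (fun v => (r * δ) * v) ⁻¹' ((fun v => r + v) ⁻¹' N) := by
    ext v
    simp only [Set.mem_ofPred_eq, Set.mem_preimage]
    rw [show r * (1 + δ * v) = r + r * δ * v by ring]
  rw [this, Real.volume_preimage_mul_left (by positivity), measure_preimage_add, h0, mul_zero]

theorem nullSingletonClass_perturb [NullSingletonClass ν] (hδ : 0 < δ) (hγ : ∀ᵐ r ∂γ, 0 < r) :
    NullSingletonClass (perturb δ γ ν) := by
  refine ⟨fun c => perturb_eq_zero (measurableSet_singleton c) ?_⟩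
  filter_upwards [hγ] with r hr
  refine Set.Subsingleton.measure_zero (fun a ha b hb => ?_) _
  have := mul_left_cancel₀ hr.ne' (Eq.trans ha (Eq.symm hb))
  exact mul_left_cancel₀ hδ.ne' (add_left_cancel this)

theorem abs_williamson_perturb_sub_le {n : ℕ} (hδ : 0 ≤ δ) (hγ : ∀ᵐ r ∂γ, 0 < r)
    (hν : ∀ᵐ v ∂ν, v ∈ I) {s : ℝ} (hs : 0 ≤ s) :
    |williamson n γ s - williamson n (perturb δ γ ν) s| ≤ n * δ := by
  have hm : Measurable fun p : ℝ × ℝ => p.1 * (1 + δ * p.2) := by fun_prop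
  have h1 : williamson n (perturb δ γ ν) s =
      ∫ p, williamsonKernel n s (p.1 * (1 + δ * p.2)) ∂(γ.prod ν) := by
    rw [williamson, perturb, integral_map hm.aemeasurable (by fun_prop)]
  have h2 : williamson n γ s = ∫ p, williamsonKernel n s p.1 ∂(γ.prod ν) := by
    rw [integral_fun_fst (fun r => williamsonKernel n s r)]
    simp [williamson]
  have i1 : Integrable (fun p : ℝ × ℝ => williamsonKernel n s (p.1 * (1 + δ * p.2)))
      (γ.prod ν) :=
    (integrable_williamsonKernel (ae_perturb_pos hδ hγ hν) hs).comp_measurable hm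
  have i2 : Integrable (fun p : ℝ × ℝ => williamsonKernel n s p.1) (γ.prod ν) :=
    (integrable_williamsonKernel hγ hs).comp_fst ν
  rw [h1, h2, ← integral_sub i2 i1, ← Real.norm_eq_abs]
  refine (norm_integral_le_of_norm_le_const (C := n * δ) ?_).trans (by simp)
  filter_upwards [Measure.quasiMeasurePreserving_fst.ae hγ,
    Measure.quasiMeasurePreserving_snd.ae hν] with p hp1 hp2
  rw [Real.norm_eq_abs, abs_sub_comm]
  refine williamsonKernel_scale hs hp1 ⟨?_, ?_⟩
  · have := mul_nonneg hδ hp2.1; linarith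
  · have := mul_le_of_le_one_right hδ hp2.2; linarith

end Perturb

/-! ### Density of the three families -/

/-- A multivariate Archimedean generator is uniformly close to the Williamson transform of a
probability measure on a countable subset of `(0,∞)`. -/
theorem exists_countable_williamson_close {n : ℕ} (hn : n ≠ 0) {C : Copula (n + 1)} {ψ : ℝ≥0 → I}
    (hψ : IsGenerator ψ) (hC : ∀ z : Fin (n + 1) → ℝ≥0, C (fun i => ψ (z i)) = ψ (∑ i, z i))
    {η : ℝ} (hη : 0 < η) :
    ∃ γ : Measure ℝ, IsProbabilityMeasure γ ∧ (∀ᵐ r ∂γ, 0 < r) ∧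
      (∃ S : Set ℝ, S.Countable ∧ ∀ᵐ r ∂γ, r ∈ S) ∧
      ∀ s : ℝ≥0, |(ψ s : ℝ) - williamson n γ s| ≤ η := by
  obtain ⟨W, ε, hε, hW0, hW1, hW⟩ := hψ.exists_weights hn
    (fun ε k hk j => C.iterDiff_nonneg hψ.antitone hC ε hk j) hη
  set x : ℕ → ℝ := fun k => (k + 1) * ε with hx
  set γ : Measure ℝ := Measure.sum fun k => ENNReal.ofReal (W k) • Measure.dirac (x k) with hγ
  have hprob : IsProbabilityMeasure γ := by
    constructor
    rw [hγ, Measure.sum_apply _ .univ]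
    simp only [Measure.smul_apply, measure_univ, smul_eq_mul, mul_one]
    rw [← ENNReal.ofReal_tsum_of_nonneg hW0 hW1.summable, hW1.tsum_eq, ENNReal.ofReal_one]
  have hrange : ∀ᵐ r ∂γ, r ∈ Set.range x := by
    rw [hγ, Measure.ae_sum_iff]
    intro k
    refine Measure.ae_smul_measure ?_ _
    rw [ae_dirac_iff (p := (· ∈ Set.range x)) (Set.countable_range x).measurableSet]
    exact ⟨k, rfl⟩
  have hpos : ∀ᵐ r ∂γ, 0 < r := by
    filter_upwards [hrange]
    rintro _ ⟨k, rfl⟩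
    positivity
  refine ⟨γ, hprob, hpos, ⟨_, Set.countable_range x, hrange⟩, fun s => ?_⟩
  have hw : williamson n γ s = ∑' k : ℕ, W k * williamsonKernel n s ((k + 1) * ε) := by
    rw [williamson, hγ, integral_sum_measure (hγ ▸ integrable_williamsonKernel hpos s.coe_nonneg)]
    refine tsum_congr fun k => ?_
    rw [integral_smul_measure, integral_dirac, ENNReal.toReal_ofReal (hW0 k), smul_eq_mul]
  rw [hw]
  exact hW s

theorem exists_archimedean_close {n : ℕ} (hn : n ≠ 0) {C : Copula (n + 1)} {ψ : ℝ≥0 → I}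
    (hC : ∀ z : Fin (n + 1) → ℝ≥0, C (fun i => ψ (z i)) = ψ (∑ i, z i))
    {γ : Measure ℝ} [IsProbabilityMeasure γ] (hγ : ∀ᵐ r ∂γ, 0 < r) {η : ℝ}
    (h : ∀ s : ℝ≥0, |(ψ s : ℝ) - williamson n γ s| ≤ η) :
    ∃ C' : ArchimedeanCopula (n + 1), dist C C'.1 ≤ (n + 2) * η ∧
      C'.1.measure = (simplexMixture n γ).map
        fun p i => williamsonGenerator n γ (simplexVector p i) := by
  have := isProbabilityMeasure_simplexMixture hn hγ
  have hψ' := isGenerator_williamson hn hγ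
  obtain ⟨C', hm, hC'⟩ := hψ'.exists_copula measurable_simplexVector
    (simplexVector_survival hn hγ)
  refine ⟨⟨C', _, hψ', hC'⟩, ?_, hm⟩
  have := Copula.dist_le_of_generator hψ' hC (C'.apply_generator hψ' hC')
    ((abs_nonneg _).trans (h 0)) fun z => by rw [coe_williamsonGenerator hγ]; exact h z
  refine this.trans_eq ?_
  push_cast
  ring

/-- Reduction to radial laws: it suffices to replace a countably carried γ₀, at cost nδ, by a law
whose copula has the required type. -/
theorem dense_of_williamson {n : ℕ} (hn : n ≠ 0) {P : ArchimedeanCopula (n + 1) → Prop}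
    (hP : ∀ γ₀ : Measure ℝ, IsProbabilityMeasure γ₀ → (∀ᵐ r ∂γ₀, 0 < r) →
      (∃ S : Set ℝ, S.Countable ∧ ∀ᵐ r ∂γ₀, r ∈ S) → ∀ δ > 0,
      ∃ γ : Measure ℝ, ∃ _ : IsProbabilityMeasure γ, (∀ᵐ r ∂γ, 0 < r) ∧
        (∀ s : ℝ≥0, |williamson n γ₀ s - williamson n γ s| ≤ n * δ) ∧
        ∀ C : ArchimedeanCopula (n + 1), C.1.measure = (simplexMixture n γ).map
          (fun p i => williamsonGenerator n γ (simplexVector p i)) → P C) :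
    Dense {C | P C} := by
  refine Metric.dense_iff.2 fun C r hr => ?_
  obtain ⟨ψ, hψ, hC⟩ := C.2
  have hC' := C.1.apply_generator hψ hC
  -- The generators end up within δ + nδ of each other, hence the copulas within (n+2)(n+1)δ = r/2.
  set δ : ℝ := r / (2 * (n + 2) * (n + 1)) with hδ
  have hδ0 : 0 < δ := by positivity
  obtain ⟨γ₀, h1, h2, h3, h4⟩ := exists_countable_williamson_close hn hψ hC' hδ0
  obtain ⟨γ, h5, h6, h7, h8⟩ := hP γ₀ h1 h2 h3 δ hδ0
  obtain ⟨D, hD, hDm⟩ := exists_archimedean_close hn hC' h6 (η := (n + 1) * δ) fun s =>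
    (abs_sub_le _ (williamson n γ₀ s) _).trans (by linarith [h4 s, h7 s])
  refine ⟨D, ?_, h8 D hDm⟩
  rw [Metric.mem_ball, dist_comm]
  refine lt_of_le_of_lt hD ?_
  have : ((n : ℝ) + 2) * ((n + 1) * δ) = r / 2 := by rw [hδ]; field_simp
  rw [this]
  linarith

/-- With `d = n + 1 ≥ 3`: the Archimedean copulas with purely discrete, absolutely continuous, and
purely singular continuous structure are each dense in `(C_ar^d, d_∞)`. -/
theorem mainTheorem6 (n : ℕ) (hn : 3 ≤ n + 1) :
    Dense {C : ArchimedeanCopula (n + 1) | C.1.discreteComponent Set.univ = 1} ∧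
    Dense {C : ArchimedeanCopula (n + 1) | C.1.IsAbsolutelyContinuous} ∧
    Dense {C : ArchimedeanCopula (n + 1) | C.1.singularComponent Set.univ = 1} := by
  have hn0 : n ≠ 0 := by omega
  refine ⟨dense_of_williamson hn0 fun γ₀ h1 h2 ⟨S, hS, hS'⟩ δ hδ => ?_,
    dense_of_williamson hn0 fun γ₀ h1 h2 _ δ hδ => ?_,
    dense_of_williamson hn0 fun γ₀ h1 h2 ⟨S, hS, hS'⟩ δ hδ => ?_⟩
  · refine ⟨γ₀, h1, h2, fun s => ?_, fun C hC => discreteComponent_williamson hn0 h2 hC hS hS'⟩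
    rw [sub_self, abs_zero]
    positivity
  · have hprob : IsProbabilityMeasure ((volume : Measure ℝ).restrict I) :=
      ⟨by rw [Measure.restrict_apply_univ]; simp [unitInterval]⟩
    have hI : ∀ᵐ v ∂(volume : Measure ℝ).restrict I, v ∈ I := ae_restrict_mem measurableSet_Icc
    have hpos := ae_perturb_pos hδ.le h2 hI
    exact ⟨perturb δ γ₀ (volume.restrict I), inferInstance, hpos,
      fun s => abs_williamson_perturb_sub_le hδ.le h2 hI s.coe_nonneg,
      fun C hC => isAbsolutelyContinuous_williamson hn0 hpos hC
        (perturb_absolutelyContinuous hδ h2 Measure.absolutelyContinuous_restrict)⟩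
  · obtain ⟨ν, hν, hνa, hνK⟩ := exists_measure_cantorSet
    have hI : ∀ᵐ v ∂ν, v ∈ I := hνK.mono fun v hv => cantorSet_subset_unitInterval hv
    have hpos := ae_perturb_pos hδ.le h2 hI
    have := nullSingletonClass_perturb (ν := ν) hδ h2
    -- The perturbed radius lies in a countable union of affine copies of the Cantor set.
    -- Countability of S is what keeps this carrier null.
    set E : Set ℝ := ⋃ r ∈ S, (fun v => r * (1 + δ * v)) '' cantorSet with hE
    have hEm : MeasurableSet E := .biUnion hS fun r _ =>
      (isCompact_cantorSet.image (by fun_prop)).isClosed.measurableSet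
    have hE0 : volume E = 0 := (measure_biUnion_null_iff hS).2 fun r _ => by
      refine volume_image_eq_zero_of_lipschitzOnWith (K := ‖r * δ‖₊) ?_ volume_cantorSet
      refine LipschitzWith.lipschitzOnWith (LipschitzWith.of_dist_le_mul fun v w => ?_)
      rw [dist_eq_norm, dist_eq_norm, coe_nnnorm, ← norm_mul]
      exact le_of_eq (congrArg _ (by ring))
    have hEae : ∀ᵐ r ∂perturb δ γ₀ ν, r ∈ E := by
      refine perturb_eq_zero hEm.compl ?_
      filter_upwards [hS'] with r hr
      refine measure_mono_null (t := {v | v ∈ cantorSet}ᶜ) (fun v hv hvK => hv ?_) hνK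
      exact Set.mem_biUnion hr ⟨v, hvK, rfl⟩
    exact ⟨perturb δ γ₀ ν, inferInstance, hpos,
      fun s => abs_williamson_perturb_sub_le hδ.le h2 hI s.coe_nonneg,
      fun C hC => singularComponent_williamson hn0 hpos hC hEm hE0 hEae⟩
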